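/- Let $d\ge 2$, let $U\subseteq\mathbb R^d$ be a connected (non-empty) open coordinate domain with coordinates $x^i$, let $g_{ij}$ be a smooth, symmetric, nondegenerate metric (of any signature) on $U$, and let $V$ be a smooth real function on $U$. Consider the Klein–Gordon equation $$H:=\Delta u+V(x)u=0,\qquad \Delta u=\tfrac{1}{\sqrt{|g|}}\,\partial_i\bigl(\sqrt{|g|}\,g^{ij}\partial_j u\bigr),$$ and its Lagrangian $L=\tfrac12\sqrt{|g|}\,g^{ij}u_{,i}u_{,j}-\tfrac12\sqrt{|g|}\,V u^2$. For a smooth vector field $X=\xi^i(x,u)\partial_i+\eta(x,u)\partial_u$ on $U\times\mathbb R$ let $X^{[1]},X^{[2]}$ be its first and second prolongations and $D_i$ the total derivative. $X$ is a *Lie point symmetry* of the equation if $X^{[2]}H=\lambda H$ for some function $\lambda$ on the second jet space (equivalently, $X^{[2]}H=0$ whenever $H=0$); it is a *Noether point symmetry* of $L$ if $X^{[1]}L+L\,D_i\xi^i=D_iA^i$ for some smooth $A^i(x,u)$. Let $G_{LS}$ and $G_{NS}$ be the sets of all Lie, respectively Noether, point symmetries, and let $\mathcal S=\{\,b(x)\partial_u:\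 b\in C^\infty(U),\ \Delta b+Vb=0\,\}$ be the superposition fields. Then $G_{LS}$ and $G_{NS}$ are real Lie algebras under the commutator of vector fields, $G_{NS}\subseteq G_{LS}$, $\mathcal S$ is contained in both and is an ideal of both, and $$G_{LS}=G_{NS}\oplus\mathbb R\,u\partial_u$$ as vector spaces; in particular $u\partial_u\in G_{LS}\setminus G_{NS}$, and up to adding a constant multiple of $u\partial_u$ every Lie point symmetry is a Noether point symmetry. Consequently: (a) if $\dim(G_{LS}/\mathcal S)=n<\infty$, then $n\ge1$ and $\dim(G_{NS}/\mathcal S)=n-1$; (b) if $G\subseteq G_{LS}$ is any Lie subalgebra with $u\partial_u\in G$ and $\dim G=n<\infty$, then $n\ge 1$, $\dim(G\cap G_{NS})=n-1$ and $G=(G\cap G_{NS})\oplus\mathbb R\,u\partial_u$. (In particular this holds for $G=G_{LS}$ whenever that is finite-dimensional.) -/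

import Mathlib

open scoped ContDiff

noncomputable section

namespace KleinGordon

/-! ## Coordinates, jets, derivatives -/

/-- The coordinates `x = (x⁰, …, x^{d-1})`. -/
abbrev Coord (d : ℕ) := Fin d → ℝ

/-- The space of variables `(x, u)`. -/
abbrev J0 (d : ℕ) := Coord d × ℝ

/-- The first jet space, with points `(x, u, u_i)`. -/
abbrev J1 (d : ℕ) := Coord d × ℝ × Coord d

/-- The second jet space, with points `(x, u, u_i, u_ij)`; the actual jets are the points with
`u_ij = u_ji`, and this is required wherever jets are quantified over. -/
abbrev J2 (d : ℕ) := Coord d × ℝ × Coord d × (Fin d → Fin d → ℝ)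

variable {d : ℕ}

/-- `∂f/∂x^i` for a function of `x`. -/
def pd (i : Fin d) (f : Coord d → ℝ) (x : Coord d) : ℝ := fderiv ℝ f x (Pi.single i 1)

/-- `∂F/∂x^i` for a function of `(x, u)`. -/
def pdx (i : Fin d) (F : J0 d → ℝ) (z : J0 d) : ℝ := fderiv ℝ F z (Pi.single i 1, 0)

/-- `∂F/∂u` for a function of `(x, u)`. -/
def pdu (F : J0 d → ℝ) (z : J0 d) : ℝ := fderiv ℝ F z (0, 1)

/-- The total derivative `D_i F = F_{,i} + u_i F_{,u}` of a function of `(x, u)`. -/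
def tot (i : Fin d) (F : J0 d → ℝ) (z : J0 d) (p : Coord d) : ℝ :=
  pdx i F z + p i * pdu F z

/-- The second total derivative `D_i D_j F` of a function of `(x, u)`. -/
def tot₂ (i j : Fin d) (F : J0 d → ℝ) (z : J0 d) (p : Coord d) (q : Fin d → Fin d → ℝ) : ℝ :=
  pdx i (pdx j F) z + p j * pdx i (pdu F) z + p i * pdx j (pdu F) z
    + p i * p j * pdu (pdu F) z + q i j * pdu F z

/-! ## The Klein–Gordon equation and its Lagrangian -/

/-- A smooth metric tensor (of any signature) on the coordinate domain `U`. -/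
structure IsMetric (U : TopologicalSpace.Opens (Coord d))
    (g : Coord d → Matrix (Fin d) (Fin d) ℝ) : Prop where
  smooth : ∀ i j, ContDiffOn ℝ ∞ (fun x => g x i j) U
  symm : ∀ x ∈ U, (g x).IsSymm
  nondegenerate : ∀ x ∈ U, (g x).det ≠ 0

/-- `√|g|`. -/
def sqrtDet (g : Coord d → Matrix (Fin d) (Fin d) ℝ) (x : Coord d) : ℝ := √|(g x).det|

/-- The Laplace operator `Δf = |g|^{-1/2} ∂_i (|g|^{1/2} g^{ij} ∂_j f)` of the metric `g`. -/
def laplacian (g : Coord d → Matrix (Fin d) (Fin d) ℝ) (f : Coord d → ℝ) (x : Coord d) : ℝ :=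
  (1 / sqrtDet g x) *
    ∑ i, pd i (fun y => sqrtDet g y * ∑ j, (g y)⁻¹ i j * pd j f y) x

/-- The function `H(x, u, u_i, u_ij) = Δu + V u` on the second jet space. -/
def kgFun (g : Coord d → Matrix (Fin d) (Fin d) ℝ) (V : Coord d → ℝ) : J2 d → ℝ :=
  fun w => (1 / sqrtDet g w.1) * (∑ i, ∑ j,
      (pd i (fun y => sqrtDet g y * (g y)⁻¹ i j) w.1 * w.2.2.1 j
        + sqrtDet g w.1 * (g w.1)⁻¹ i j * w.2.2.2 i j))
    + V w.1 * w.2.1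

/-- The Lagrangian `L = ½ √|g| g^{ij} u_i u_j - ½ √|g| V u²` on the first jet space. -/
def kgLagrangian (g : Coord d → Matrix (Fin d) (Fin d) ℝ) (V : Coord d → ℝ) : J1 d → ℝ :=
  fun w => 1 / 2 * sqrtDet g w.1 * (∑ i, ∑ j, (g w.1)⁻¹ i j * w.2.2 i * w.2.2 j)
    - 1 / 2 * sqrtDet g w.1 * V w.1 * w.2.1 ^ 2

/-! ## The Lie algebra of smooth vector fields on `U × ℝ` -/

/-- Smooth vector fields `ξ^i(x,u) ∂_i + η(x,u) ∂_u` on `U × ℝ`. To have one representative for each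
field, the coefficients are extended by zero outside `U × ℝ`. -/
def pointFieldSubmodule (U : TopologicalSpace.Opens (Coord d)) :
    Submodule ℝ (J0 d → J0 d) where
  carrier := {X | ContDiffOn ℝ ∞ X ((U : Set (Coord d)) ×ˢ Set.univ) ∧ ∀ z, z.1 ∉ U → X z = 0}
  add_mem' := fun {X Y} hX hY =>
    ⟨hX.1.add hY.1, fun z hz => by simp [hX.2 z hz, hY.2 z hz]⟩
  zero_mem' := ⟨contDiffOn_const, fun _ _ => rfl⟩
  smul_mem' := fun c X hX => ⟨contDiffOn_const.smul hX.1, fun z hz => by simp [hX.2 z hz]⟩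

/-- The space of smooth vector fields on `U × ℝ`. -/
def PointField (U : TopologicalSpace.Opens (Coord d)) : Type := pointFieldSubmodule U

variable {U : TopologicalSpace.Opens (Coord d)}

instance : AddCommGroup (PointField U) := inferInstanceAs (AddCommGroup (pointFieldSubmodule U))
instance : Module ℝ (PointField U) := inferInstanceAs (Module ℝ (pointFieldSubmodule U))

namespace PointField

/-- The coefficients of a vector field, as a map `(x, u) ↦ (ξ, η)`. -/
def val (X : PointField U) : J0 d → J0 d := Subtype.val X

/-- The coefficient `ξ^k`. -/
def xi (X : PointField U) (k : Fin d) : J0 d → ℝ := fun z => (X.val z).1 k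

/-- The coefficient `η`. -/
def eta (X : PointField U) : J0 d → ℝ := fun z => (X.val z).2

theorem ext_val {X Y : PointField U} (h : ∀ z, X.val z = Y.val z) : X = Y :=
  Subtype.ext (funext h)

theorem val_add (X Y : PointField U) : (X + Y).val = X.val + Y.val := rfl
theorem val_smul (c : ℝ) (X : PointField U) : (c • X).val = c • X.val := rfl
theorem val_zero : (0 : PointField U).val = 0 := rfl

theorem val_eq_zero (X : PointField U) {z : J0 d} (hz : z.1 ∉ U) : X.val z = 0 := X.2.2 z hz

theorem isOpen_domain (U : TopologicalSpace.Opens (Coord d)) :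
    IsOpen ((U : Set (Coord d)) ×ˢ (Set.univ : Set ℝ)) := U.isOpen.prod isOpen_univ

theorem contDiffOn (X : PointField U) :
    ContDiffOn ℝ ∞ X.val ((U : Set (Coord d)) ×ˢ Set.univ) := X.2.1

theorem contDiffAt (X : PointField U) {z : J0 d} (hz : z.1 ∈ U) : ContDiffAt ℝ ∞ X.val z :=
  X.contDiffOn.contDiffAt ((isOpen_domain U).mem_nhds ⟨hz, trivial⟩)

theorem differentiableAt (X : PointField U) {z : J0 d} (hz : z.1 ∈ U) :
    DifferentiableAt ℝ X.val z := (X.contDiffAt hz).differentiableAt (by simp)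

/-- The Lie bracket (commutator) of vector fields. -/
instance : Bracket (PointField U) (PointField U) where
  bracket X Y := ⟨VectorField.lieBracket ℝ X.val Y.val, by
    constructor
    · have h : ∀ A B : PointField U, ContDiffOn ℝ ∞ (fun z => fderiv ℝ A.val z (B.val z))
          ((U : Set (Coord d)) ×ˢ Set.univ) := fun A B =>
        (A.contDiffOn.fderiv_of_isOpen (isOpen_domain U) (by simp)).clm_apply B.contDiffOn
      exact (h Y X).sub (h X Y)
    · intro z hz
      simp [VectorField.lieBracket, X.val_eq_zero hz, Y.val_eq_zero hz]⟩

theorem val_lie (X Y : PointField U) : ⁅X, Y⁆.val = VectorField.lieBracket ℝ X.val Y.val := rfl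

instance : LieRing (PointField U) where
  add_lie X Y Z := ext_val fun z => by
    by_cases hz : z.1 ∈ U
    · simp only [val_add, val_lie, Pi.add_apply]
      exact VectorField.lieBracket_add_left (X.differentiableAt hz) (Y.differentiableAt hz)
    · simp [val_eq_zero _ hz]
  lie_add X Y Z := ext_val fun z => by
    by_cases hz : z.1 ∈ U
    · simp only [val_add, val_lie, Pi.add_apply]
      exact VectorField.lieBracket_add_right (Y.differentiableAt hz) (Z.differentiableAt hz)
    · simp [val_eq_zero _ hz]
  lie_self X := ext_val fun z => by simp [val_lie, val_zero]
  leibniz_lie X Y Z := ext_val fun z => by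
    by_cases hz : z.1 ∈ U
    · simp only [val_add, val_lie, Pi.add_apply]
      have h : minSmoothness ℝ 2 ≤ (∞ : WithTop ℕ∞) := by
        simp only [minSmoothness_of_isRCLikeNormedField]; exact ENat.LEInfty.out
      exact VectorField.leibniz_identity_lieBracket le_rfl
        ((X.contDiffAt hz).of_le h) ((Y.contDiffAt hz).of_le h) ((Z.contDiffAt hz).of_le h)
    · simp [val_eq_zero _ hz]

instance : LieAlgebra ℝ (PointField U) where
  lie_smul c X Y := ext_val fun z => by
    by_cases hz : z.1 ∈ U
    · simp only [val_smul, val_lie, Pi.smul_apply]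
      exact VectorField.lieBracket_const_smul_right (Y.differentiableAt hz)
    · simp [val_eq_zero _ hz]

/-! ## Prolongations and point symmetries -/

/-- The coefficients `η_i = D_i η - u_k D_i ξ^k` of the first prolongation. -/
def prol₁ (X : PointField U) (z : J0 d) (p : Coord d) : Coord d :=
  fun i => tot i X.eta z p - ∑ k, p k * tot i (X.xi k) z p

/-- The coefficients `η_ij = D_i D_j η - u_k D_i D_j ξ^k - u_ik D_j ξ^k - u_jk D_i ξ^k` of the
second prolongation. -/
def prol₂ (X : PointField U) (z : J0 d) (p : Coord d) (q : Fin d → Fin d → ℝ) :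
    Fin d → Fin d → ℝ :=
  fun i j => tot₂ i j X.eta z p q - ∑ k, p k * tot₂ i j (X.xi k) z p q
    - ∑ k, q i k * tot j (X.xi k) z p - ∑ k, q j k * tot i (X.xi k) z p

/-- `X^{[1]} F`: the first prolongation of `X` applied to a function on the first jet space. -/
def apply₁ (X : PointField U) (F : J1 d → ℝ) (x : Coord d) (u : ℝ) (p : Coord d) : ℝ :=
  fderiv ℝ F (x, u, p) ((X.val (x, u)).1, (X.val (x, u)).2, X.prol₁ (x, u) p)

/-- `X^{[2]} F`: the second prolongation of `X` applied to a function on the second jet space. -/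
def apply₂ (X : PointField U) (F : J2 d → ℝ) (x : Coord d) (u : ℝ) (p : Coord d)
    (q : Fin d → Fin d → ℝ) : ℝ :=
  fderiv ℝ F (x, u, p, q)
    ((X.val (x, u)).1, (X.val (x, u)).2, X.prol₁ (x, u) p, X.prol₂ (x, u) p q)

/-- `X` is a Lie point symmetry of `Δu + V u = 0`: there is a function `lam` on the jet space with
`X^{[2]} H = lam H`. Since `lam` is an arbitrary function, this says exactly that `X^{[2]} H`
vanishes at every jet with `H = 0`. -/
def IsLieSymmetry (g : Coord d → Matrix (Fin d) (Fin d) ℝ) (V : Coord d → ℝ)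
    (X : PointField U) : Prop :=
  ∃ lam : J2 d → ℝ, ∀ x ∈ U, ∀ (u : ℝ) (p : Coord d) (q : Fin d → Fin d → ℝ),
    (∀ i j, q i j = q j i) →
      X.apply₂ (kgFun g V) x u p q = lam (x, u, p, q) * kgFun g V (x, u, p, q)

/-- `X` is a Noether point symmetry of the Lagrangian: `X^{[1]} L + L D_i ξ^i = D_i A^i` for some
smooth gauge vector `A^i(x, u)`. -/
def IsNoetherSymmetry (g : Coord d → Matrix (Fin d) (Fin d) ℝ) (V : Coord d → ℝ)
    (X : PointField U) : Prop :=
  ∃ A : J0 d → Coord d, ContDiffOn ℝ ∞ A ((U : Set (Coord d)) ×ˢ Set.univ) ∧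
    ∀ x ∈ U, ∀ (u : ℝ) (p : Coord d),
      X.apply₁ (kgLagrangian g V) x u p
          + kgLagrangian g V (x, u, p) * ∑ i, tot i (X.xi i) (x, u) p
        = ∑ i, tot i (fun z => A z i) (x, u) p

/-- `X = b(x) ∂_u` for a smooth solution `b` of `Δb + V b = 0` (superposition of solutions). -/
def IsSuperposition (g : Coord d → Matrix (Fin d) (Fin d) ℝ) (V : Coord d → ℝ)
    (X : PointField U) : Prop :=
  ∃ b : Coord d → ℝ, ContDiffOn ℝ ∞ b U ∧ (∀ x ∈ U, laplacian g b x + V x * b x = 0) ∧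
    ∀ x ∈ U, ∀ u : ℝ, X.val (x, u) = (0, b x)

open Classical in
/-- The homogeneous scaling `u ∂_u`. -/
def scaling (U : TopologicalSpace.Opens (Coord d)) : PointField U :=
  ⟨fun z => if z.1 ∈ U then (0, z.2) else 0, by
    constructor
    · exact (contDiffOn_const.prodMk contDiffOn_snd).congr fun z hz => if_pos hz.1
    · exact fun z hz => if_neg hz⟩

end PointField

end KleinGordon

end

/-!
With `w = √|g|`, `W i j = w g^{ij}` and `Z = w V`, the operator `T f = ∂_i (W i j ∂_j f) + Z f`
equals `w (Δ + V)`, and the Lagrangian is `½ W i j u_i u_j - ½ Z u²`. The whole argument is carried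
out with `T`; of the metric it uses only that `W` is smooth, symmetric and nondegenerate.

**Shape of the symmetries.** A Lie point symmetry has `ξ = ξ(x)` and `η = a(x) u + b(x)`. The part
of `X^{[2]} H` that is linear in the second derivatives has to be a multiple of `W i j u_ij`. Its
dependence on the first derivatives makes the rank-one matrix `ξ_u ξ_uᵀ` a multiple of `W`, so that
`ξ_u = 0` as `d ≥ 2` (`PreservesEquation.pdu_xi`); the terms quadratic in `u_i` then give `η_uu =
0` (`PreservesEquation.isAffine`). For a Noether symmetry, `ξ_u = 0` follows from the terms cubic
in `u_i`, and the quadratic ones show that `η_u` depends on `x` only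
(`PreservesLagrangian.isAffine`).

**Symmetries as intertwining relations.** Put `Q = ξ^k ∂_k - a`. An affine field is a Lie symmetry
iff `T b = 0` and `T Q = Q' T` for some `Q' = ξ^k ∂_k - a'` (`mem_symmetryAlgebra_iff`): on the jet
of a function `f`, the prolongation of `X` applied to `T` is `a' T f + T b - (T Q - Q' T) f`
(`jetOp_affine`). It is a Noether symmetry iff this holds with `a' = -a - ∂_k ξ^k`
(`mem_variationalAlgebra_iff`), the gauge vector being `A^i = W i j (½ u² ∂_j a + u ∂_j b)`.
Closure under commutators is immediate from these relations, because `T [Q₁, Q₂] = [Q₁', Q₂'] T`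
(`Intertwines.bracket`).

**Comparison.** Since `T` is formally self-adjoint, passing to adjoints in `T Q = Q' T` shows that
`T` commutes with multiplication by `h = ∂_k ξ^k + a + a'`, hence that `W i j ∂_j h = 0`; on
coefficients this is the identity `sum_deriv_defect₂`. So `h = 2 c` is constant on the connected
domain `U`, and replacing `X` by `X - c u ∂_u` replaces `a, a'` by `a - c, a' - c`, which makes `h`
vanish: every Lie symmetry is a Noether symmetry up to a multiple of `u ∂_u`
(`exists_sub_smul_scaling_mem`). The field `u ∂_u` itself has `h = 2`. The dimension counts are
rank-nullity for a linear functional that vanishes on the Noether symmetries and is `1` at `u ∂_u`.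
-/

noncomputable section

namespace KleinGordon

/-! ### Second-order operators in divergence form and their intertwiners -/

section Algebraic

variable {n A : Type*} [Fintype n] [CommRing A] [Algebra ℝ A]

/-- The derivation `f ↦ ξ^k ∂_k f`, for commuting derivations `∂_k = D k` that play the part of
partial derivatives. -/
def vectorDeriv (D : n → Derivation ℝ A A) (ξ : n → A) : Derivation ℝ A A := ∑ k, ξ k • D k

theorem vectorDeriv_apply (D : n → Derivation ℝ A A) (ξ : n → A) (f : A) :
    vectorDeriv D ξ f = ∑ k, ξ k * D k f := by
  change Derivation.coeFnAddMonoidHom (∑ k, ξ k • D k) f = _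
  rw [map_sum, Finset.sum_apply]
  rfl

/-- The divergence `∂_k ξ^k`. -/
def divergence (D : n → Derivation ℝ A A) (ξ : n → A) : A := ∑ k, D k (ξ k)

/-- The operator `T f = ∂_i (W i j ∂_j f) + Z f` in divergence form. -/
def divOp (D : n → Derivation ℝ A A) (W : n → n → A) (Z : A) : A →ₗ[ℝ] A :=
  ∑ i, (D i).toLinearMap ∘ₗ (∑ j, LinearMap.mulLeft ℝ (W i j) ∘ₗ (D j).toLinearMap)
    + LinearMap.mulLeft ℝ Z

theorem divOp_apply (D : n → Derivation ℝ A A) (W : n → n → A) (Z f : A) :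
    divOp D W Z f = ∑ i, D i (∑ j, W i j * D j f) + Z * f := by
  simp [divOp]

/-- The coefficients `∂_i W i j` of the first-order part of `divOp`. -/
def divCoeff (D : n → Derivation ℝ A A) (W : n → n → A) (j : n) : A := ∑ i, D i (W i j)

/-- The relation `T Q = Q' T` between `T = divOp D W Z` and the first-order operators
`Q = ξ^k ∂_k - a` and `Q' = ξ^k ∂_k - a'`. -/
def Intertwines (D : n → Derivation ℝ A A) (W : n → n → A) (Z : A) (ξ : n → A) (a a' : A) : Prop :=
  ∀ f, divOp D W Z (vectorDeriv D ξ f - a * f)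
    = vectorDeriv D ξ (divOp D W Z f) - a' * divOp D W Z f

/-- The coefficient of `∂_j ∂_k` in `T Q - Q' T`; only its symmetric part matters, and it is not
symmetrised here. -/
def defect₂ (D : n → Derivation ℝ A A) (W : n → n → A) (ξ : n → A) (a a' : A) (j k : n) : A :=
  2 * (∑ i, W i j * D i (ξ k)) + (a' - a) * W j k - vectorDeriv D ξ (W j k)

/-- The coefficient of `∂_k` in `T Q - Q' T`. -/
def defect₁ (D : n → Derivation ℝ A A) (W : n → n → A) (ξ : n → A) (a a' : A) (k : n) : A :=
  divOp D W 0 (ξ k) + (a' - a) * divCoeff D W k - 2 * (∑ i, W i k * D i a)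
    - vectorDeriv D ξ (divCoeff D W k)

/-- The coefficient of order zero in `T Q - Q' T`. -/
def defect₀ (D : n → Derivation ℝ A A) (W : n → n → A) (Z : A) (ξ : n → A) (a a' : A) : A :=
  a' * Z - divOp D W Z a - vectorDeriv D ξ Z

variable {D : n → Derivation ℝ A A} {W : n → n → A} {Z : A} {ξ : n → A} {a a' : A}

theorem divOp_eq (f : A) : divOp D W Z f
    = ∑ i, ∑ j, W i j * D i (D j f) + ∑ j, divCoeff D W j * D j f + Z * f := by
  rw [divOp_apply]
  congr 1
  simp only [divCoeff, Finset.sum_mul]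
  rw [Finset.sum_comm (f := fun j i => D i (W i j) * D j f), ← Finset.sum_add_distrib]
  refine Finset.sum_congr rfl fun i _ => ?_
  rw [map_sum, ← Finset.sum_add_distrib]
  refine Finset.sum_congr rfl fun j _ => ?_
  simp only [Derivation.leibniz, smul_eq_mul]; ring

theorem divOp_mul (hW : ∀ i j, W i j = W j i) (f g : A) : divOp D W Z (f * g)
    = f * divOp D W Z g + g * divOp D W 0 f + 2 * ∑ i, ∑ j, W i j * D i f * D j g := by
  have h : ∑ i, ∑ j, W i j * D i f * D j g = ∑ i, ∑ j, W i j * D j f * D i g := by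
    rw [Finset.sum_comm]
    exact Finset.sum_congr rfl fun i _ => Finset.sum_congr rfl fun j _ => by rw [hW]
  rw [two_mul]
  nth_rewrite 2 [h]
  simp only [divOp_eq, mul_add, Finset.mul_sum, Derivation.leibniz, smul_eq_mul, map_add,
    Finset.sum_add_distrib, zero_mul, add_zero]
  simp only [mul_left_comm, mul_comm]
  ring

theorem deriv_divOp (hD : ∀ i j f, D i (D j f) = D j (D i f)) (k : n) (f : A) :
    D k (divOp D W Z f) = divOp D W Z (D k f) + ∑ i, ∑ j, D k (W i j) * D i (D j f)
      + ∑ j, D k (divCoeff D W j) * D j f + D k Z * f := by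
  simp only [divOp_eq, map_add, map_sum, Derivation.leibniz, smul_eq_mul, Finset.sum_add_distrib]
  have h : ∀ i j, D k (D i (D j f)) = D i (D j (D k f)) := fun i j => by rw [hD k i, hD k j]
  simp only [h, hD k, mul_comm]
  ring

theorem defect_eq (hD : ∀ i j f, D i (D j f) = D j (D i f)) (hW : ∀ i j, W i j = W j i) (f : A) :
    divOp D W Z (vectorDeriv D ξ f - a * f)
        - (vectorDeriv D ξ (divOp D W Z f) - a' * divOp D W Z f)
      = ∑ j, ∑ k, defect₂ D W ξ a a' j k * D j (D k f) + ∑ k, defect₁ D W ξ a a' k * D k f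
        + defect₀ D W Z ξ a a' * f := by
  have e1 : divOp D W Z (vectorDeriv D ξ f) = ∑ k, ξ k * divOp D W Z (D k f)
      + ∑ k, divOp D W 0 (ξ k) * D k f
      + ∑ j, ∑ k, 2 * (∑ i, W i j * D i (ξ k)) * D j (D k f) := by
    rw [vectorDeriv_apply, map_sum, Finset.sum_comm, ← Finset.sum_add_distrib,
      ← Finset.sum_add_distrib]
    refine Finset.sum_congr rfl fun k _ => ?_
    rw [divOp_mul hW, Finset.sum_comm, Finset.mul_sum]
    simp only [mul_assoc, Finset.sum_mul, ← Finset.mul_sum]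
    ring
  have e2 : vectorDeriv D ξ (divOp D W Z f) = ∑ k, ξ k * divOp D W Z (D k f)
      + ∑ i, ∑ j, vectorDeriv D ξ (W i j) * D i (D j f)
      + ∑ j, vectorDeriv D ξ (divCoeff D W j) * D j f + vectorDeriv D ξ Z * f := by
    simp only [vectorDeriv_apply, deriv_divOp hD, mul_add, Finset.sum_add_distrib]
    congr 1
    · congr 1
      · congr 1
        simp only [Finset.mul_sum, Finset.sum_mul]
        rw [Finset.sum_comm]
        refine Finset.sum_congr rfl fun i _ => ?_
        rw [Finset.sum_comm]
        exact Finset.sum_congr rfl fun j _ => Finset.sum_congr rfl fun k _ => by ring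
      · simp only [Finset.mul_sum, Finset.sum_mul]
        rw [Finset.sum_comm]
        exact Finset.sum_congr rfl fun j _ => Finset.sum_congr rfl fun k _ => by ring
    · rw [Finset.sum_mul]
      exact Finset.sum_congr rfl fun k _ => by ring
  have e3 : divOp D W Z (a * f) = a * divOp D W Z f + f * divOp D W 0 a
      + ∑ k, 2 * (∑ i, W i k * D i a) * D k f := by
    rw [divOp_mul hW, Finset.sum_comm, Finset.mul_sum]
    simp only [Finset.sum_mul, mul_assoc, ← Finset.mul_sum]
  have e4 : divOp D W Z a = divOp D W 0 a + Z * a := by simp [divOp_apply]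
  have e5 := divOp_eq (D := D) (W := W) (Z := Z) f
  rw [map_sub, e1, e2, e3]
  simp only [defect₀, defect₁, defect₂, sub_mul, add_mul, Finset.sum_sub_distrib,
    Finset.sum_add_distrib, mul_assoc a, mul_assoc a', ← Finset.mul_sum, e4, e5]
  ring

theorem sum_mul_eq_zero_of_symm {c q : n → n → A} (hc : ∀ j k, c j k + c k j = 0)
    (hq : ∀ j k, q j k = q k j) : ∑ j, ∑ k, c j k * q j k = 0 := by
  set S := ∑ j, ∑ k, c j k * q j k with hS
  have h : S + S = 0 := by
    nth_rewrite 2 [hS]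
    rw [Finset.sum_comm, hS]
    simp only [← Finset.sum_add_distrib]
    refine Finset.sum_eq_zero fun j _ => Finset.sum_eq_zero fun k _ => ?_
    rw [hq k j, ← add_mul, hc, zero_mul]
  have h2 : (2 : ℝ) • S = 0 := by rw [two_smul, h]
  simpa using h2

theorem intertwines_of_defect (hD : ∀ i j f, D i (D j f) = D j (D i f))
    (hW : ∀ i j, W i j = W j i)
    (h₂ : ∀ j k, defect₂ D W ξ a a' j k + defect₂ D W ξ a a' k j = 0)
    (h₁ : ∀ k, defect₁ D W ξ a a' k = 0) (h₀ : defect₀ D W Z ξ a a' = 0) :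
    Intertwines D W Z ξ a a' := by
  intro f
  rw [← sub_eq_zero, defect_eq hD hW]
  simp only [h₁, h₀, zero_mul, Finset.sum_const_zero, add_zero]
  exact sum_mul_eq_zero_of_symm h₂ fun j k => hD j k f

/-- The coefficients of `T Q - Q' T` are read off by applying it to `1`, to the coordinate functions
`X k`, and to the products `X j * X k`. -/
theorem Intertwines.defect [DecidableEq n] (hD : ∀ i j f, D i (D j f) = D j (D i f))
    (hW : ∀ i j, W i j = W j i) {X : n → A} (hX : ∀ i j, D i (X j) = if i = j then 1 else 0)
    (h : Intertwines D W Z ξ a a') :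
    (∀ j k, defect₂ D W ξ a a' j k + defect₂ D W ξ a a' k j = 0) ∧
      (∀ k, defect₁ D W ξ a a' k = 0) ∧ defect₀ D W Z ξ a a' = 0 := by
  have key := fun f => (defect_eq (Z := Z) (ξ := ξ) (a := a) (a' := a') hD hW f).symm.trans
    (sub_eq_zero.2 (h f))
  have h₀ : defect₀ D W Z ξ a a' = 0 := by simpa using key 1
  have hite : ∀ i (c : Prop) [Decidable c] (f : A),
      D i (if c then f else 0) = if c then D i f else 0 := fun i c _ f => by split_ifs <;> simp
  have h₁ : ∀ k, defect₁ D W ξ a a' k = 0 := fun k => by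
    simpa [h₀, hX, hite] using key (X k)
  refine ⟨fun j k => ?_, h₁, h₀⟩
  simpa [h₀, h₁, hX, hite, mul_add, Finset.sum_add_distrib, add_comm] using key (X j * X k)

/-- The coefficient form of the adjointness argument: since `T` is formally self-adjoint, the
divergence of the second-order coefficient of `T Q - Q' T` differs from the first-order coefficient
by the gradient of `h = ∂_k ξ^k + a + a'`, contracted with `W`. -/
theorem sum_deriv_defect₂ (hD : ∀ i j f, D i (D j f) = D j (D i f))
    (hW : ∀ i j, W i j = W j i) (k : n) :
    ∑ j, D j (defect₂ D W ξ a a' j k + defect₂ D W ξ a a' k j)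
      = 2 * (defect₁ D W ξ a a' k + ∑ j, W j k * D j (divergence D ξ + a + a')) := by
  have e0 : ∀ j, defect₂ D W ξ a a' j k + defect₂ D W ξ a a' k j
      = 2 * (∑ i, W i j * D i (ξ k) + ∑ i, W i k * D i (ξ j) + (a' - a) * W j k
        - vectorDeriv D ξ (W j k)) := fun j => by
    simp only [defect₂]; rw [hW k j]; ring
  have e1 : ∑ j, D j (∑ i, W i j * D i (ξ k)) = divOp D W 0 (ξ k) := by
    rw [divOp_apply, zero_mul, add_zero]
    exact Finset.sum_congr rfl fun j _ => by simp only [hW j]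
  have e2 : ∑ j, D j (∑ i, W i k * D i (ξ j)) = ∑ i, W i k * D i (divergence D ξ)
      + ∑ j, ∑ i, D j (W i k) * D i (ξ j) := by
    simp only [divergence, map_sum, Derivation.leibniz, smul_eq_mul, Finset.sum_add_distrib,
      Finset.mul_sum]
    congr 1
    · rw [Finset.sum_comm]
      exact Finset.sum_congr rfl fun i _ => Finset.sum_congr rfl fun j _ => by rw [hD]
    · exact Finset.sum_congr rfl fun i _ => Finset.sum_congr rfl fun j _ => by ring
  have e3 : ∑ j, D j ((a' - a) * W j k) = (a' - a) * divCoeff D W k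
      + ∑ j, W j k * D j a' - ∑ j, W j k * D j a := by
    simp only [divCoeff, Derivation.leibniz, smul_eq_mul, Finset.sum_add_distrib, map_sub, mul_sub,
      Finset.mul_sum, Finset.sum_sub_distrib]
    ring
  have e4 : ∑ j, D j (vectorDeriv D ξ (W j k)) = vectorDeriv D ξ (divCoeff D W k)
      + ∑ j, ∑ i, D j (W i k) * D i (ξ j) := by
    have e5 : ∑ j, ∑ i, D j (W i k) * D i (ξ j) = ∑ j, ∑ i, D j (ξ i) * D i (W j k) := by
      rw [Finset.sum_comm]
      exact Finset.sum_congr rfl fun i _ => Finset.sum_congr rfl fun j _ => by ring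
    rw [e5]
    simp only [vectorDeriv_apply, divCoeff, map_sum, Derivation.leibniz, smul_eq_mul,
      Finset.sum_add_distrib]
    congr 1
    · exact Finset.sum_congr rfl fun j _ => Finset.sum_congr rfl fun i _ => by rw [hD]
    · exact Finset.sum_congr rfl fun i _ => Finset.sum_congr rfl fun j _ => by ring
  have e6 : ∑ j, D j (defect₂ D W ξ a a' j k + defect₂ D W ξ a a' k j)
      = 2 * (∑ j, D j (∑ i, W i j * D i (ξ k)) + ∑ j, D j (∑ i, W i k * D i (ξ j))
        + ∑ j, D j ((a' - a) * W j k) - ∑ j, D j (vectorDeriv D ξ (W j k))) := by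
    rw [← Finset.sum_add_distrib, ← Finset.sum_add_distrib, ← Finset.sum_sub_distrib,
      Finset.mul_sum]
    refine Finset.sum_congr rfl fun j _ => ?_
    rw [e0, ← map_add, ← map_add, ← map_sub, two_mul, map_add, ← two_mul]
  rw [e6, e1, e2, e3, e4]
  simp only [defect₁, map_add, mul_add, Finset.sum_add_distrib]
  ring

/-- The components of the commutator of `ξ₁^k ∂_k` and `ξ₂^k ∂_k`. -/
def flowBracket (D : n → Derivation ℝ A A) (ξ₁ ξ₂ : n → A) (k : n) : A :=
  vectorDeriv D ξ₁ (ξ₂ k) - vectorDeriv D ξ₂ (ξ₁ k)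

theorem vectorDeriv_flowBracket (hD : ∀ i j f, D i (D j f) = D j (D i f)) (ξ₁ ξ₂ : n → A) (f : A) :
    vectorDeriv D (flowBracket D ξ₁ ξ₂) f
      = vectorDeriv D ξ₁ (vectorDeriv D ξ₂ f) - vectorDeriv D ξ₂ (vectorDeriv D ξ₁ f) := by
  have h : ∀ ξ₁ ξ₂ : n → A, vectorDeriv D ξ₁ (vectorDeriv D ξ₂ f)
      = ∑ k, vectorDeriv D ξ₁ (ξ₂ k) * D k f + ∑ k, ∑ i, ξ₁ i * ξ₂ k * D i (D k f) := by
    intro ξ₁ ξ₂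
    rw [vectorDeriv_apply D ξ₂, map_sum, ← Finset.sum_add_distrib]
    refine Finset.sum_congr rfl fun k _ => ?_
    rw [Derivation.leibniz, vectorDeriv_apply D ξ₁ (D k f), smul_eq_mul, smul_eq_mul,
      Finset.mul_sum, add_comm]
    congr 1
    · ring
    · exact Finset.sum_congr rfl fun i _ => by ring
  rw [h, h, vectorDeriv_apply]
  have h' : ∑ k, ∑ i, ξ₂ i * ξ₁ k * D i (D k f) = ∑ k, ∑ i, ξ₁ i * ξ₂ k * D i (D k f) := by
    rw [Finset.sum_comm]
    exact Finset.sum_congr rfl fun i _ => Finset.sum_congr rfl fun k _ => by rw [hD]; ring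
  rw [h']
  simp only [flowBracket, sub_mul, Finset.sum_sub_distrib]
  ring

/-- From `T Q₁ = Q₁' T` and `T Q₂ = Q₂' T` follows `T [Q₁, Q₂] = [Q₁', Q₂'] T`. -/
theorem Intertwines.bracket (hD : ∀ i j f, D i (D j f) = D j (D i f)) {ξ₁ ξ₂ : n → A}
    {a₁ a₁' a₂ a₂' : A} (h₁ : Intertwines D W Z ξ₁ a₁ a₁') (h₂ : Intertwines D W Z ξ₂ a₂ a₂') :
    Intertwines D W Z (flowBracket D ξ₁ ξ₂) (vectorDeriv D ξ₁ a₂ - vectorDeriv D ξ₂ a₁)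
      (vectorDeriv D ξ₁ a₂' - vectorDeriv D ξ₂ a₁') := by
  intro f
  have e₁ := h₁ (vectorDeriv D ξ₂ f - a₂ * f)
  have e₂ := h₂ (vectorDeriv D ξ₁ f - a₁ * f)
  rw [h₂ f] at e₁
  rw [h₁ f] at e₂
  have e : vectorDeriv D (flowBracket D ξ₁ ξ₂) f
        - (vectorDeriv D ξ₁ a₂ - vectorDeriv D ξ₂ a₁) * f
      = (vectorDeriv D ξ₁ (vectorDeriv D ξ₂ f - a₂ * f) - a₁ * (vectorDeriv D ξ₂ f - a₂ * f))
        - (vectorDeriv D ξ₂ (vectorDeriv D ξ₁ f - a₁ * f)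
          - a₂ * (vectorDeriv D ξ₁ f - a₁ * f)) := by
    rw [vectorDeriv_flowBracket hD]
    simp only [map_sub, Derivation.leibniz, smul_eq_mul]
    ring
  rw [e, map_sub, e₁, e₂, vectorDeriv_flowBracket hD]
  simp only [map_sub, Derivation.leibniz, smul_eq_mul]
  ring

theorem divergence_flowBracket (hD : ∀ i j f, D i (D j f) = D j (D i f)) (ξ₁ ξ₂ : n → A) :
    divergence D (flowBracket D ξ₁ ξ₂)
      = vectorDeriv D ξ₁ (divergence D ξ₂) - vectorDeriv D ξ₂ (divergence D ξ₁) := by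
  have h : ∀ ξ₁ ξ₂ : n → A, ∑ k, D k (vectorDeriv D ξ₁ (ξ₂ k))
      = ∑ k, ∑ i, D k (ξ₁ i) * D i (ξ₂ k) + vectorDeriv D ξ₁ (divergence D ξ₂) := by
    intro ξ₁ ξ₂
    simp only [divergence, map_sum (vectorDeriv D ξ₁)]
    rw [← Finset.sum_add_distrib]
    refine Finset.sum_congr rfl fun k _ => ?_
    simp only [vectorDeriv_apply, map_sum, Derivation.leibniz, smul_eq_mul,
      ← Finset.sum_add_distrib]
    exact Finset.sum_congr rfl fun i _ => by rw [hD k i]; ring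
  have h' : ∑ k, ∑ i, D k (ξ₁ i) * D i (ξ₂ k) = ∑ k, ∑ i, D k (ξ₂ i) * D i (ξ₁ k) := by
    rw [Finset.sum_comm]
    exact Finset.sum_congr rfl fun i _ => Finset.sum_congr rfl fun k _ => mul_comm _ _
  rw [divergence]
  simp only [flowBracket, map_sub, Finset.sum_sub_distrib]
  rw [h, h, h']
  ring

theorem vectorDeriv_add (ξ₁ ξ₂ : n → A) (f : A) :
    vectorDeriv D (ξ₁ + ξ₂) f = vectorDeriv D ξ₁ f + vectorDeriv D ξ₂ f := by
  simp [vectorDeriv_apply, add_mul, Finset.sum_add_distrib]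

theorem vectorDeriv_smul (c : ℝ) (ξ : n → A) (f : A) :
    vectorDeriv D (c • ξ) f = c • vectorDeriv D ξ f := by
  simp [vectorDeriv_apply, Finset.smul_sum]

theorem vectorDeriv_zero (f : A) : vectorDeriv D 0 f = 0 := by
  simp [vectorDeriv_apply]

theorem flowBracket_zero (ξ : n → A) : flowBracket D ξ 0 = 0 := by
  funext k; simp [flowBracket, vectorDeriv_zero]

theorem divergence_add (ξ₁ ξ₂ : n → A) :
    divergence D (ξ₁ + ξ₂) = divergence D ξ₁ + divergence D ξ₂ := by
  simp [divergence, Finset.sum_add_distrib]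

theorem divergence_smul (c : ℝ) (ξ : n → A) : divergence D (c • ξ) = c • divergence D ξ := by
  simp [divergence, Finset.smul_sum]

theorem divergence_zero : divergence D (0 : n → A) = 0 := by simp [divergence]

theorem Intertwines.add {ξ₁ ξ₂ : n → A} {a₁ a₁' a₂ a₂' : A} (h₁ : Intertwines D W Z ξ₁ a₁ a₁')
    (h₂ : Intertwines D W Z ξ₂ a₂ a₂') :
    Intertwines D W Z (ξ₁ + ξ₂) (a₁ + a₂) (a₁' + a₂') := by
  intro f
  have e : vectorDeriv D (ξ₁ + ξ₂) f - (a₁ + a₂) * f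
      = (vectorDeriv D ξ₁ f - a₁ * f) + (vectorDeriv D ξ₂ f - a₂ * f) := by
    rw [vectorDeriv_add]; ring
  rw [e, map_add, h₁, h₂, vectorDeriv_add]; ring

theorem Intertwines.smul {ξ : n → A} {a a' : A} (c : ℝ) (h : Intertwines D W Z ξ a a') :
    Intertwines D W Z (c • ξ) (c • a) (c • a') := by
  intro f
  rw [vectorDeriv_smul, smul_mul_assoc, ← smul_sub, map_smul, h, vectorDeriv_smul, smul_mul_assoc,
    smul_sub]

theorem intertwines_scaling : Intertwines D W Z 0 1 1 := by
  intro f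
  simp [vectorDeriv_zero]

theorem intertwines_zero : Intertwines D W Z 0 0 0 := by
  intro f
  simp [vectorDeriv_zero]

end Algebraic

variable {d : ℕ} {U : TopologicalSpace.Opens (Coord d)}

/-! ### The algebra of smooth functions on the domain -/

/-- The smooth functions on `U`, as functions on the subtype: those that have an extension to the
whole space which is smooth on `U`. -/
def smoothSubalgebra (U : TopologicalSpace.Opens (Coord d)) : Subalgebra ℝ (U → ℝ) where
  carrier := {f | ∃ F : Coord d → ℝ, ContDiffOn ℝ ∞ F U ∧ ∀ x : U, F x = f x}
  mul_mem' := fun ⟨F, hF, h⟩ ⟨G, hG, h'⟩ => ⟨F * G, hF.mul hG, fun x => by simp [h, h']⟩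
  add_mem' := fun ⟨F, hF, h⟩ ⟨G, hG, h'⟩ => ⟨F + G, hF.add hG, fun x => by simp [h, h']⟩
  algebraMap_mem' c := ⟨fun _ => c, contDiffOn_const, fun _ => rfl⟩

/-- The algebra of smooth functions on `U`. -/
def SmoothFun (U : TopologicalSpace.Opens (Coord d)) : Type := smoothSubalgebra U

namespace SmoothFun

instance : CommRing (SmoothFun U) := inferInstanceAs (CommRing (smoothSubalgebra U))
instance : Algebra ℝ (SmoothFun U) := inferInstanceAs (Algebra ℝ (smoothSubalgebra U))
/-- The underlying function. -/
def toFun (f : SmoothFun U) : U → ℝ := Subtype.val f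
instance : CoeFun (SmoothFun U) fun _ => U → ℝ := ⟨toFun⟩

theorem ext_apply {f g : SmoothFun U} (h : ∀ x, f x = g x) : f = g := Subtype.ext (funext h)

@[simp] theorem sum_apply {ι : Type*} (s : Finset ι) (f : ι → SmoothFun U) (x : U) :
    (∑ i ∈ s, f i) x = ∑ i ∈ s, (f i) x := by
  have : (∑ i ∈ s, f i).toFun = ∑ i ∈ s, (f i).toFun :=
    map_sum (smoothSubalgebra U).val f s
  exact (congrFun this x).trans (Finset.sum_apply x s fun i => (f i).toFun)

@[simp] theorem add_apply (f g : SmoothFun U) (x : U) : (f + g) x = f x + g x := rfl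
@[simp] theorem sub_apply (f g : SmoothFun U) (x : U) : (f - g) x = f x - g x := rfl
@[simp] theorem neg_apply (f : SmoothFun U) (x : U) : (-f) x = -f x := rfl
@[simp] theorem mul_apply (f g : SmoothFun U) (x : U) : (f * g) x = f x * g x := rfl
@[simp] theorem smul_apply (c : ℝ) (f : SmoothFun U) (x : U) : (c • f) x = c * f x := rfl
@[simp] theorem zero_apply (x : U) : (0 : SmoothFun U) x = 0 := rfl
@[simp] theorem one_apply (x : U) : (1 : SmoothFun U) x = 1 := rfl
@[simp] theorem two_apply (x : U) : (2 : SmoothFun U) x = 2 := rfl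

/-- The restriction to `U` of a function that is smooth on `U`. -/
def restrict (F : Coord d → ℝ) (hF : ContDiffOn ℝ ∞ F U) : SmoothFun U :=
  ⟨fun x => F x, F, hF, fun _ => rfl⟩

/-- The extension by zero; only its values on `U` matter. -/
def extend (f : SmoothFun U) : Coord d → ℝ := Function.extend Subtype.val f.toFun 0

theorem extend_apply (f : SmoothFun U) (x : U) : f.extend x = f x :=
  Subtype.val_injective.extend_apply _ _ _

theorem contDiffOn_extend (f : SmoothFun U) : ContDiffOn ℝ ∞ f.extend U := by
  obtain ⟨F, hF, h⟩ := f.2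
  exact hF.congr fun x hx => (extend_apply f ⟨x, hx⟩).trans (h ⟨x, hx⟩).symm

theorem contDiffAt_extend (f : SmoothFun U) (x : U) : ContDiffAt ℝ ∞ f.extend x :=
  f.contDiffOn_extend.contDiffAt (U.isOpen.mem_nhds x.2)

theorem differentiableAt_extend (f : SmoothFun U) (x : U) : DifferentiableAt ℝ f.extend x :=
  (f.contDiffAt_extend x).differentiableAt (by simp)

theorem contDiffOn_pd {F : Coord d → ℝ} (hF : ContDiffOn ℝ ∞ F U) (i : Fin d) :
    ContDiffOn ℝ ∞ (pd i F) U :=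
  (hF.fderiv_of_isOpen U.isOpen (by simp)).clm_apply contDiffOn_const

theorem pd_congr {F G : Coord d → ℝ} (h : ∀ x : U, F x = G x) (i : Fin d) (x : U) :
    pd i F x = pd i G x := by
  have : F =ᶠ[nhds (x : Coord d)] G :=
    Filter.eventuallyEq_of_mem (U.isOpen.mem_nhds x.2) fun y hy => h ⟨y, hy⟩
  rw [pd, pd, this.fderiv_eq]

/-- The partial derivative `∂_i` as a derivation of the algebra of smooth functions on `U`. -/
def deriv (i : Fin d) : Derivation ℝ (SmoothFun U) (SmoothFun U) :=
  Derivation.mk'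
    { toFun := fun f => restrict (pd i f.extend) (contDiffOn_pd f.contDiffOn_extend i)
      map_add' := fun f g => ext_apply fun x => by
        change pd i _ x = pd i _ x + pd i _ x
        rw [pd_congr (G := f.extend + g.extend) fun y => by simp [extend_apply], pd,
          fderiv_add (f.differentiableAt_extend x) (g.differentiableAt_extend x)]
        rfl
      map_smul' := fun c f => ext_apply fun x => by
        change pd i _ x = c * pd i _ x
        rw [pd_congr (G := c • f.extend) fun y => by simp [extend_apply], pd,
          fderiv_const_smul (f.differentiableAt_extend x)]
        rfl }
    fun f g => ext_apply fun x => by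
      change pd i _ x = f x * pd i _ x + g x * pd i _ x
      rw [pd_congr (G := f.extend * g.extend) fun y => by simp [extend_apply], pd,
        fderiv_mul (f.differentiableAt_extend x) (g.differentiableAt_extend x)]
      simp [extend_apply, pd]

theorem deriv_apply (i : Fin d) (f : SmoothFun U) (x : U) :
    (deriv i f) x = pd i f.extend x := rfl

theorem deriv_apply_of_eq (i : Fin d) {f : SmoothFun U} {F : Coord d → ℝ}
    (h : ∀ x : U, F x = f x) (x : U) : (deriv i f) x = pd i F x :=
  pd_congr (fun y => (extend_apply f y).trans (h y).symm) i x

theorem hasFDerivAt_extend (f : SmoothFun U) (x : U) :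
    HasFDerivAt f.extend
      (∑ k, (deriv k f) x • ContinuousLinearMap.proj (R := ℝ) (φ := fun _ : Fin d => ℝ) k) x := by
  have e : fderiv ℝ f.extend x = ∑ k, (deriv k f) x •
      ContinuousLinearMap.proj (R := ℝ) (φ := fun _ : Fin d => ℝ) k := by
    refine ContinuousLinearMap.ext fun v => ?_
    conv_lhs => rw [pi_eq_sum_univ' v]
    simp [deriv_apply, pd, mul_comm]
  exact e ▸ (f.differentiableAt_extend x).hasFDerivAt

theorem deriv_comm (i j : Fin d) (f : SmoothFun U) : deriv i (deriv j f) = deriv j (deriv i f) := by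
  refine ext_apply fun x => ?_
  have h : ∀ i j : Fin d, (deriv i (deriv j f)) x
      = fderiv ℝ (fderiv ℝ f.extend) x (Pi.single i 1) (Pi.single j 1) := by
    intro i j
    rw [deriv_apply_of_eq (F := pd j f.extend) i (fun _ => rfl), pd]
    have hd : DifferentiableAt ℝ (fderiv ℝ f.extend) x :=
      ((f.contDiffOn_extend.fderiv_of_isOpen (m := ∞) U.isOpen (by simp)).contDiffAt
        (U.isOpen.mem_nhds x.2)).differentiableAt (by simp)
    have := (hd.hasFDerivAt.clm_apply
      (hasFDerivAt_const (Pi.single j (1 : ℝ) : Coord d) (x : Coord d)))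
    unfold pd
    rw [this.fderiv]
    simp
  rw [h, h]
  exact ((f.contDiffAt_extend x).isSymmSndFDerivAt (by
    simp only [minSmoothness_of_isRCLikeNormedField]; exact ENat.LEInfty.out)).eq _ _

/-- The coordinate function `x^j`. -/
def coord (j : Fin d) : SmoothFun U := restrict (fun x => x j) (contDiff_apply ℝ ℝ j).contDiffOn

theorem deriv_coord (i j : Fin d) :
    deriv i (coord j : SmoothFun U) = if i = j then 1 else 0 := by
  refine ext_apply fun x => ?_
  rw [deriv_apply_of_eq (F := fun x => x j) i (fun _ => rfl), pd,
    (hasFDerivAt_apply j (x : Coord d)).fderiv]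
  split_ifs with h
  · subst h; simp
  · simp [Ne.symm h]

theorem exists_mul_eq_one (f : SmoothFun U) (hf : ∀ x, f x ≠ 0) :
    ∃ g : SmoothFun U, f * g = 1 := by
  refine ⟨restrict (fun x => (f.extend x)⁻¹) (f.contDiffOn_extend.inv fun x hx => ?_), ?_⟩
  · rw [extend_apply f ⟨x, hx⟩]; exact hf _
  · refine ext_apply fun x => ?_
    change f x * (f.extend x)⁻¹ = 1
    rw [extend_apply, mul_inv_cancel₀ (hf x)]

theorem exists_eq_algebraMap (hU : IsPreconnected (U : Set (Coord d))) (f : SmoothFun U)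
    (hf : ∀ i, deriv i f = 0) : ∃ c : ℝ, f = algebraMap ℝ _ c := by
  obtain ⟨c, hc⟩ := U.isOpen.exists_is_const_of_fderiv_eq_zero hU
    (f := f.extend) (fun x hx => (f.differentiableAt_extend ⟨x, hx⟩).differentiableWithinAt)
    (fun x hx => by
      rw [(f.hasFDerivAt_extend ⟨x, hx⟩).fderiv]
      simp [hf])
  exact ⟨c, ext_apply fun x => (f.extend_apply x).symm.trans (hc x x.2)⟩

end SmoothFun

open SmoothFun

/-! ### The metric coefficients and the equation on jets -/

theorem contDiffOn_det {n : Type*} [Fintype n] [DecidableEq n] {s : Set (Coord d)}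
    {M : Coord d → Matrix n n ℝ} (hM : ∀ i j, ContDiffOn ℝ ∞ (fun x => M x i j) s) :
    ContDiffOn ℝ ∞ (fun x => (M x).det) s := by
  simp only [Matrix.det_apply']
  exact ContDiffOn.sum fun σ _ => contDiffOn_const.mul (contDiffOn_prod fun i _ => hM _ _)

namespace IsMetric

variable {g : Coord d → Matrix (Fin d) (Fin d) ℝ}

theorem contDiffOn_inv (hg : IsMetric U g) (i j : Fin d) :
    ContDiffOn ℝ ∞ (fun x => (g x)⁻¹ i j) U := by
  have h : ∀ x, (g x)⁻¹ i j = ((g x).det)⁻¹ * (g x).adjugate i j := fun x => by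
    rw [Matrix.inv_def, Ring.inverse_eq_inv', Matrix.smul_apply, smul_eq_mul]
  simp only [h, Matrix.adjugate_apply]
  refine ((contDiffOn_det hg.smooth).inv hg.nondegenerate).mul (contDiffOn_det fun k l => ?_)
  by_cases hk : k = j
  · subst hk; simpa using contDiffOn_const
  · simpa [Matrix.updateRow_ne hk] using hg.smooth k l

theorem sqrtDet_ne_zero (hg : IsMetric U g) {x : Coord d} (hx : x ∈ U) : sqrtDet g x ≠ 0 :=
  (Real.sqrt_pos.2 (abs_pos.2 (hg.nondegenerate x hx))).ne'

theorem contDiffOn_sqrtDet (hg : IsMetric U g) : ContDiffOn ℝ ∞ (sqrtDet g) U := by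
  have h := contDiffOn_det hg.smooth
  exact (h.abs hg.nondegenerate).sqrt fun x hx => abs_ne_zero.2 (hg.nondegenerate x hx)

/-- The coefficients `√|g| g^{ij}`. -/
def density (hg : IsMetric U g) (i j : Fin d) : SmoothFun U :=
  restrict (fun x => sqrtDet g x * (g x)⁻¹ i j) (hg.contDiffOn_sqrtDet.mul (hg.contDiffOn_inv i j))

/-- The coefficient `√|g| V`. -/
def potential (hg : IsMetric U g) {V : Coord d → ℝ} (hV : ContDiffOn ℝ ∞ V U) : SmoothFun U :=
  restrict (fun x => sqrtDet g x * V x) (hg.contDiffOn_sqrtDet.mul hV)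

/-- The factor `1 / √|g|`. -/
def invSqrtDet (hg : IsMetric U g) : SmoothFun U :=
  restrict (fun x => 1 / sqrtDet g x)
    (contDiffOn_const.div hg.contDiffOn_sqrtDet fun _ hx => hg.sqrtDet_ne_zero hx)

theorem invSqrtDet_ne_zero (hg : IsMetric U g) (x : U) : hg.invSqrtDet x ≠ 0 :=
  one_div_ne_zero (hg.sqrtDet_ne_zero x.2)

theorem density_symm (hg : IsMetric U g) (i j : Fin d) : hg.density i j = hg.density j i :=
  SmoothFun.ext_apply fun x => by
    have h := congrFun (congrFun (hg.symm x x.2).inv i) j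
    change sqrtDet g x * (g x)⁻¹ i j = sqrtDet g x * (g x)⁻¹ j i
    rw [← h, Matrix.transpose_apply]

theorem density_det_ne_zero (hg : IsMetric U g) (x : U) :
    (Matrix.of fun i j => hg.density i j x).det ≠ 0 := by
  have h : (Matrix.of fun i j => hg.density i j x) = sqrtDet g x • (g x)⁻¹ := by
    ext i j; rfl
  rw [h, Matrix.det_smul, Matrix.det_nonsing_inv, Ring.inverse_eq_inv']
  exact mul_ne_zero (pow_ne_zero _ (hg.sqrtDet_ne_zero x.2)) (inv_ne_zero (hg.nondegenerate x x.2))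

end IsMetric

/-- The derivative of `f` at `x` in the direction `v`. -/
def along (v : Coord d) (f : SmoothFun U) (x : U) : ℝ := ∑ k, v k * deriv k f x

/-- The operator `divOp deriv W Z` as a function of the 2-jet `(x, u, p, q)`. -/
def jetOp (W : Fin d → Fin d → SmoothFun U) (Z : SmoothFun U) (x : U) (u : ℝ) (p : Coord d)
    (q : Fin d → Fin d → ℝ) : ℝ :=
  ∑ i, ∑ j, W i j x * q i j + ∑ j, divCoeff deriv W j x * p j + Z x * u

/-- The derivative of `jetOp` in the direction `v` of `x`, the other jet variables being fixed. -/
def jetOpVar (W : Fin d → Fin d → SmoothFun U) (Z : SmoothFun U) (v : Coord d) (x : U)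
    (u : ℝ) (p : Coord d) (q : Fin d → Fin d → ℝ) : ℝ :=
  ∑ i, ∑ j, along v (W i j) x * q i j + ∑ j, along v (divCoeff deriv W j) x * p j + along v Z x * u

theorem hasFDerivAt_extend_fst {E : Type*} [NormedAddCommGroup E] [NormedSpace ℝ E]
    (f : SmoothFun U) (x : U) (e : E) :
    HasFDerivAt (fun w : Coord d × E => f.extend w.1)
      ((∑ k, deriv k f x • ContinuousLinearMap.proj (R := ℝ) (φ := fun _ : Fin d => ℝ) k).comp
        (ContinuousLinearMap.fst ℝ (Coord d) E)) (↑x, e) :=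
  HasFDerivAt.comp (x := ((x : Coord d), e)) (g := f.extend) (f := Prod.fst)
    (f.hasFDerivAt_extend x) hasFDerivAt_fst

section
variable {g : Coord d → Matrix (Fin d) (Fin d) ℝ} {V : Coord d → ℝ}

theorem kgFun_eq (hg : IsMetric U g) (hV : ContDiffOn ℝ ∞ V U) (x : U) (u : ℝ) (p : Coord d)
    (q : Fin d → Fin d → ℝ) : kgFun g V (x, u, p, q)
      = hg.invSqrtDet x * jetOp hg.density (hg.potential hV) x u p q := by
  have h1 : ∀ i j, pd i (fun y => sqrtDet g y * (g y)⁻¹ i j) x = deriv i (hg.density i j) x :=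
    fun i j => (deriv_apply_of_eq i (fun _ => rfl) x).symm
  have h2 : V x = hg.invSqrtDet x * hg.potential hV x := by
    change V x = 1 / sqrtDet g x * (sqrtDet g x * V x)
    have := hg.sqrtDet_ne_zero x.2
    field_simp
  have h3 : ∑ j, divCoeff deriv hg.density j x * p j
      = ∑ i, ∑ j, deriv i (hg.density i j) x * p j := by
    rw [Finset.sum_comm]
    exact Finset.sum_congr rfl fun j _ => by rw [divCoeff, sum_apply, Finset.sum_mul]
  have h4 : ∀ i j, sqrtDet g x * (g x)⁻¹ i j = hg.density i j x := fun i j => rfl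
  have h5 : 1 / sqrtDet g x = hg.invSqrtDet x := rfl
  rw [jetOp, h3]
  simp only [kgFun, h1, h2, h4, h5, Finset.sum_add_distrib]
  ring

theorem fderiv_kgFun (hg : IsMetric U g) (hV : ContDiffOn ℝ ∞ V U) (x : U) (u : ℝ) (p : Coord d)
    (q : Fin d → Fin d → ℝ) (v : J2 d) :
    fderiv ℝ (kgFun g V) (x, u, p, q) v = hg.invSqrtDet x *
        (jetOpVar hg.density (hg.potential hV) v.1 x u p q
          + jetOp hg.density (hg.potential hV) x v.2.1 v.2.2.1 v.2.2.2)
      + along v.1 hg.invSqrtDet x * jetOp hg.density (hg.potential hV) x u p q := by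
  set W := hg.density
  set Z := hg.potential hV
  set G := hg.invSqrtDet
  have hev : kgFun g V =ᶠ[nhds ((x : Coord d), u, p, q)] fun w => G.extend w.1 *
      (∑ i, ∑ j, (W i j).extend w.1 * w.2.2.2 i j
        + ∑ j, (divCoeff deriv W j).extend w.1 * w.2.2.1 j + Z.extend w.1 * w.2.1) := by
    refine Filter.eventuallyEq_of_mem
      ((U.isOpen.preimage continuous_fst).mem_nhds (x := ((x : Coord d), u, p, q)) x.2)
      fun w hw => ?_
    obtain ⟨y, u', p', q'⟩ := w
    simp only [extend_apply _ ⟨y, hw⟩]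
    exact kgFun_eq hg hV ⟨y, hw⟩ u' p' q'
  have hq : ∀ i j, HasFDerivAt (fun w : J2 d => w.2.2.2 i j) _ ((x : Coord d), u, p, q) :=
    fun i j => ((ContinuousLinearMap.proj (R := ℝ) (φ := fun _ : Fin d => ℝ) j).comp
      ((ContinuousLinearMap.proj (R := ℝ) (φ := fun _ : Fin d => Fin d → ℝ) i).comp
        ((ContinuousLinearMap.snd ℝ (Coord d) (Fin d → Fin d → ℝ)).comp
          ((ContinuousLinearMap.snd ℝ ℝ (Coord d × (Fin d → Fin d → ℝ))).comp
            (ContinuousLinearMap.snd ℝ (Coord d)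
              (ℝ × Coord d × (Fin d → Fin d → ℝ))))))).hasFDerivAt
  have hp : ∀ j, HasFDerivAt (fun w : J2 d => w.2.2.1 j) _ ((x : Coord d), u, p, q) :=
    fun j => ((ContinuousLinearMap.proj (R := ℝ) (φ := fun _ : Fin d => ℝ) j).comp
      ((ContinuousLinearMap.fst ℝ (Coord d) (Fin d → Fin d → ℝ)).comp
        ((ContinuousLinearMap.snd ℝ ℝ (Coord d × (Fin d → Fin d → ℝ))).comp
          (ContinuousLinearMap.snd ℝ (Coord d) (ℝ × Coord d × (Fin d → Fin d → ℝ)))))).hasFDerivAt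
  have hu : HasFDerivAt (fun w : J2 d => w.2.1) _ ((x : Coord d), u, p, q) :=
    ((ContinuousLinearMap.fst ℝ ℝ (Coord d × (Fin d → Fin d → ℝ))).comp
      (ContinuousLinearMap.snd ℝ (Coord d) (ℝ × Coord d × (Fin d → Fin d → ℝ)))).hasFDerivAt
  have hf := fun f : SmoothFun U => hasFDerivAt_extend_fst f x (u, p, q)
  have h := (hf G).mul (((HasFDerivAt.fun_sum (u := Finset.univ) fun i _ =>
    HasFDerivAt.fun_sum (u := Finset.univ) fun j _ => (hf (W i j)).mul (hq i j)).add
    (HasFDerivAt.fun_sum (u := Finset.univ) fun j _ =>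
      (hf (divCoeff deriv W j)).mul (hp j))).add ((hf Z).mul hu))
  refine (congrArg (fun T => T v) (hev.fderiv_eq.trans (HasFDerivAt.fderiv h))).trans ?_
  simp [extend_apply, jetOp, jetOpVar, along, Finset.sum_add_distrib, mul_comm]
  ring

theorem kgLagrangian_eq (hg : IsMetric U g) (hV : ContDiffOn ℝ ∞ V U) (x : U) (u : ℝ)
    (p : Coord d) : kgLagrangian g V (x, u, p)
      = 1 / 2 * ∑ i, ∑ j, hg.density i j x * p i * p j - 1 / 2 * hg.potential hV x * u ^ 2 := by
  have h1 : ∀ i j, hg.density i j x = sqrtDet g x * (g x)⁻¹ i j := fun i j => rfl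
  have h2 : hg.potential hV x = sqrtDet g x * V x := rfl
  simp only [kgLagrangian, h1, h2, mul_assoc, ← Finset.mul_sum]

theorem fderiv_kgLagrangian (hg : IsMetric U g) (hV : ContDiffOn ℝ ∞ V U) (x : U) (u : ℝ)
    (p : Coord d) (v : J1 d) :
    fderiv ℝ (kgLagrangian g V) (x, u, p) v
      = 1 / 2 * ∑ i, ∑ j, along v.1 (hg.density i j) x * p i * p j
        + ∑ i, ∑ j, hg.density i j x * p i * v.2.2 j
        - 1 / 2 * along v.1 (hg.potential hV) x * u ^ 2 - hg.potential hV x * u * v.2.1 := by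
  have hWs := fun i j => hg.density_symm i j
  set W := hg.density
  set Z := hg.potential hV
  have hev : kgLagrangian g V =ᶠ[nhds ((x : Coord d), u, p)] fun w =>
      (1 / 2 : ℝ) * (∑ i, ∑ j, (W i j).extend w.1 * w.2.2 i * w.2.2 j)
        - (1 / 2 : ℝ) * (Z.extend w.1 * (w.2.1 * w.2.1)) := by
    refine Filter.eventuallyEq_of_mem
      ((U.isOpen.preimage continuous_fst).mem_nhds (x := ((x : Coord d), u, p)) x.2)
      fun w hw => ?_
    obtain ⟨y, u', p'⟩ := w
    simp only [extend_apply _ ⟨y, hw⟩]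
    exact (kgLagrangian_eq hg hV ⟨y, hw⟩ u' p').trans (by ring)
  have hp : ∀ j, HasFDerivAt (fun w : J1 d => w.2.2 j) _ ((x : Coord d), u, p) :=
    fun j => ((ContinuousLinearMap.proj (R := ℝ) (φ := fun _ : Fin d => ℝ) j).comp
      ((ContinuousLinearMap.snd ℝ ℝ (Coord d)).comp
        (ContinuousLinearMap.snd ℝ (Coord d) (ℝ × Coord d)))).hasFDerivAt
  have hu : HasFDerivAt (fun w : J1 d => w.2.1) _ ((x : Coord d), u, p) :=
    ((ContinuousLinearMap.fst ℝ ℝ (Coord d)).comp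
      (ContinuousLinearMap.snd ℝ (Coord d) (ℝ × Coord d))).hasFDerivAt
  have hf := fun f : SmoothFun U => hasFDerivAt_extend_fst f x (u, p)
  have h := ((HasFDerivAt.fun_sum (u := Finset.univ) fun i _ =>
    HasFDerivAt.fun_sum (u := Finset.univ) fun j _ =>
      ((hf (W i j)).mul (hp i)).mul (hp j)).const_mul (1 / 2 : ℝ)).sub
    (((hf Z).mul (hu.mul hu)).const_mul (1 / 2 : ℝ))
  refine (congrArg (fun T => T v) (hev.fderiv_eq.trans (HasFDerivAt.fderiv h))).trans ?_
  have hs : ∑ i, ∑ j, p j * (W i j x * v.2.2 i) = ∑ i, ∑ j, p i * W i j x * v.2.2 j := by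
    rw [Finset.sum_comm]
    exact Finset.sum_congr rfl fun i _ => Finset.sum_congr rfl fun j _ => by rw [hWs]; ring
  simp [extend_apply, along, Finset.sum_add_distrib, mul_comm]
  rw [hs]
  ring
end

/-! ### Functions affine in `u` and restrictions to fibres -/

theorem fderiv_of_affine {F : J0 d → ℝ} {f b : SmoothFun U}
    (h : ∀ (x : U) (u : ℝ), F (x, u) = f x * u + b x) (x : U) (u : ℝ) (v : J0 d) :
    fderiv ℝ F (x, u) v = along v.1 f x * u + f x * v.2 + along v.1 b x := by
  have hev : F =ᶠ[nhds ((x : Coord d), u)] fun w => f.extend w.1 * w.2 + b.extend w.1 := by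
    refine Filter.eventuallyEq_of_mem
      ((U.isOpen.preimage continuous_fst).mem_nhds (x := ((x : Coord d), u)) x.2) fun w hw => ?_
    obtain ⟨y, u'⟩ := w
    simp only [extend_apply _ ⟨y, hw⟩]
    exact h ⟨y, hw⟩ u'
  have h' := ((hasFDerivAt_extend_fst f x u).mul
    (hasFDerivAt_snd (𝕜 := ℝ) (p := ((x : Coord d), u)))).add (hasFDerivAt_extend_fst b x u)
  refine (congrArg (fun T => T v) (hev.fderiv_eq.trans (HasFDerivAt.fderiv h'))).trans ?_
  simp [extend_apply, along, mul_comm]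
  ring

theorem along_single (i : Fin d) (f : SmoothFun U) (x : U) :
    along (Pi.single i 1) f x = deriv i f x := by
  simp [along, Pi.single_apply]

theorem along_zero (f : SmoothFun U) (x : U) : along 0 f x = 0 := by
  simp [along]

section Affine

variable {F : J0 d → ℝ} {f b : SmoothFun U}

theorem pdx_of_affine (h : ∀ (x : U) (u : ℝ), F (x, u) = f x * u + b x) (i : Fin d) (x : U)
    (u : ℝ) : pdx i F (x, u) = deriv i f x * u + deriv i b x := by
  rw [pdx, fderiv_of_affine h]
  simp [along_single]

theorem pdu_of_affine (h : ∀ (x : U) (u : ℝ), F (x, u) = f x * u + b x) (x : U)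
    (u : ℝ) : pdu F (x, u) = f x := by
  rw [pdu, fderiv_of_affine h]
  simp [along_zero]

theorem tot_of_affine (h : ∀ (x : U) (u : ℝ), F (x, u) = f x * u + b x) (i : Fin d) (x : U)
    (u : ℝ) (p : Coord d) :
    tot i F (x, u) p = deriv i f x * u + deriv i b x + p i * f x := by
  rw [tot, pdx_of_affine h, pdu_of_affine h]

theorem tot₂_of_affine (h : ∀ (x : U) (u : ℝ), F (x, u) = f x * u + b x) (i j : Fin d) (x : U)
    (u : ℝ) (p : Coord d) (q : Fin d → Fin d → ℝ) :
    tot₂ i j F (x, u) p q = deriv i (deriv j f) x * u + deriv i (deriv j b) x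
      + p j * deriv i f x + p i * deriv j f x + q i j * f x := by
  have hu : ∀ (x : U) (u : ℝ), pdu F (x, u) = (0 : SmoothFun U) x * u + f x := fun x u => by
    rw [pdu_of_affine h]; simp
  rw [tot₂, pdx_of_affine (pdx_of_affine h j), pdx_of_affine hu, pdx_of_affine hu,
    pdu_of_affine hu, pdu_of_affine h]
  simp

end Affine

section Fibre

variable {F : J0 d → ℝ}

theorem contDiffOn_pdu (hF : ContDiffOn ℝ ∞ F ((U : Set (Coord d)) ×ˢ Set.univ)) :
    ContDiffOn ℝ ∞ (pdu F) ((U : Set (Coord d)) ×ˢ Set.univ) :=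
  (hF.fderiv_of_isOpen (PointField.isOpen_domain U) (by simp)).clm_apply contDiffOn_const

/-- The smooth function `x ↦ F (x, u)` on `U`, for fixed `u`. -/
def fibreAt (F : J0 d → ℝ) (hF : ContDiffOn ℝ ∞ F ((U : Set (Coord d)) ×ˢ Set.univ)) (u : ℝ) :
    SmoothFun U :=
  restrict (fun x => F (x, u))
    (hF.comp (contDiff_prodMk_left u).contDiffOn fun _ hx => ⟨hx, trivial⟩)

theorem fibreAt_apply (hF : ContDiffOn ℝ ∞ F ((U : Set (Coord d)) ×ˢ Set.univ)) (u : ℝ) (x : U) :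
    fibreAt F hF u x = F (x, u) := rfl

theorem hasDerivAt_fibre (hF : ContDiffOn ℝ ∞ F ((U : Set (Coord d)) ×ˢ Set.univ)) (x : U)
    (u : ℝ) : HasDerivAt (fun t => F (x, t)) (pdu F (x, u)) u := by
  have h : DifferentiableAt ℝ F ((x : Coord d), u) := (hF.contDiffAt
    ((PointField.isOpen_domain U).mem_nhds ⟨x.2, trivial⟩)).differentiableAt (by simp)
  exact h.hasFDerivAt.comp_hasDerivAt u
    ((hasDerivAt_const u (x : Coord d)).prodMk (hasDerivAt_id u))

/-- A function with `∂_u F` affine in `u` along the fibre over `x` is quadratic in `u` there. -/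
theorem eq_of_pdu_eq (hF : ContDiffOn ℝ ∞ F ((U : Set (Coord d)) ×ˢ Set.univ)) (x : U)
    {c₁ c₀ : ℝ} (h : ∀ t, pdu F (x, t) = c₁ * t + c₀) (u : ℝ) :
    F (x, u) = c₁ * u ^ 2 / 2 + c₀ * u + F (x, 0) := by
  have hd : ∀ t, HasDerivAt (fun t => F (x, t) - (c₁ * t ^ 2 / 2 + c₀ * t)) 0 t := by
    intro t
    have h1 := (hasDerivAt_fibre hF x t).sub
      (((((hasDerivAt_id t).pow 2).const_mul c₁).div_const 2).add ((hasDerivAt_id t).const_mul c₀))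
    exact h1.congr_deriv (by rw [h]; simp; ring)
  have := is_const_of_deriv_eq_zero (fun t => (hd t).differentiableAt) (fun t => (hd t).deriv) u 0
  simp only [ne_eq, OfNat.ofNat_ne_zero, not_false_eq_true, zero_pow, mul_zero, zero_div, add_zero,
    sub_zero] at this
  linarith

end Fibre

/-! ### Vector fields affine in `u` -/

namespace PointField

theorem contDiffOn_xi (X : PointField U) (k : Fin d) :
    ContDiffOn ℝ ∞ (X.xi k) ((U : Set (Coord d)) ×ˢ Set.univ) :=
  contDiffOn_pi.1 X.contDiffOn.fst k

theorem contDiffOn_eta (X : PointField U) :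
    ContDiffOn ℝ ∞ X.eta ((U : Set (Coord d)) ×ˢ Set.univ) := X.contDiffOn.snd

/-- The vector field is `ξ^k(x) ∂_k + (a(x) u + b(x)) ∂_u`. -/
def IsAffine (X : PointField U) (ξ : Fin d → SmoothFun U) (a b : SmoothFun U) : Prop :=
  ∀ (x : U) (u : ℝ), X.val (x, u) = (fun k => ξ k x, a x * u + b x)

theorem isAffine_of_pdu {X : PointField U} (hξ : ∀ k (x : U) (u : ℝ), pdu (X.xi k) (x, u) = 0)
    (hη : ∀ (x : U) (u : ℝ), pdu X.eta (x, u) = pdu X.eta (x, 0)) :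
    X.IsAffine (fun k => fibreAt (X.xi k) (X.contDiffOn_xi k) 0)
      (fibreAt (pdu X.eta) (contDiffOn_pdu X.contDiffOn_eta) 0)
      (fibreAt X.eta X.contDiffOn_eta 0) := by
  refine fun x u => Prod.ext (funext fun k => ?_) ?_
  · have h := eq_of_pdu_eq (X.contDiffOn_xi k) x (c₁ := 0) (c₀ := 0) (fun t => by rw [hξ]; simp) u
    simp only [zero_mul, zero_div, zero_add] at h
    exact h
  · have h := eq_of_pdu_eq X.contDiffOn_eta x (c₁ := 0) (c₀ := pdu X.eta (x, 0))
      (fun t => by simp [hη x t]) u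
    simp only [zero_mul, zero_div, zero_add] at h
    exact h

section
variable {X : PointField U} {ξ : Fin d → SmoothFun U} {a a' b : SmoothFun U}

theorem IsAffine.xi (h : X.IsAffine ξ a b) (k : Fin d) (x : U) (u : ℝ) :
    X.xi k (x, u) = (0 : SmoothFun U) x * u + ξ k x := by
  simp [PointField.xi, h x u]

theorem IsAffine.eta (h : X.IsAffine ξ a b) (x : U) (u : ℝ) :
    X.eta (x, u) = a x * u + b x := by
  simp [PointField.eta, h x u]

theorem IsAffine.prol₁ (h : X.IsAffine ξ a b) (x : U) (u : ℝ) (p : Coord d) :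
    X.prol₁ (x, u) p = fun i => deriv i a x * u + deriv i b x + p i * a x
      - ∑ k, p k * deriv i (ξ k) x := by
  funext i
  simp [PointField.prol₁, tot_of_affine h.eta, tot_of_affine (h.xi _)]

theorem IsAffine.prol₂ (h : X.IsAffine ξ a b) (x : U) (u : ℝ) (p : Coord d)
    (q : Fin d → Fin d → ℝ) :
    X.prol₂ (x, u) p q = fun i j => deriv i (deriv j a) x * u + deriv i (deriv j b) x
      + p j * deriv i a x + p i * deriv j a x + q i j * a x
      - ∑ k, p k * deriv i (deriv j (ξ k)) x - ∑ k, q i k * deriv j (ξ k) x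
      - ∑ k, q j k * deriv i (ξ k) x := by
  funext i j
  simp [PointField.prol₂, tot_of_affine (h.xi _), tot₂_of_affine h.eta, tot₂_of_affine (h.xi _)]

/-- The prolongation of an affine field applied to `divOp deriv W Z`, for an arbitrary `a'`: on the
jet of a function `f` it is `a' T f + T b - (T Q - Q' T) f`, by the expansion of `T Q - Q' T` in
its coefficients. -/
theorem jetOp_affine {W : Fin d → Fin d → SmoothFun U} {Z : SmoothFun U}
    (hW : ∀ i j, W i j = W j i) (h : X.IsAffine ξ a b) (a' : SmoothFun U) (x : U) (u : ℝ)
    (p : Coord d) (q : Fin d → Fin d → ℝ) :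
    jetOpVar W Z (X.val (x, u)).1 x u p q
        + jetOp W Z x (X.val (x, u)).2 (X.prol₁ (x, u) p) (X.prol₂ (x, u) p q)
      = a' x * jetOp W Z x u p q + divOp deriv W Z b x
        - ∑ j, ∑ k, defect₂ deriv W ξ a a' j k x * q j k
        - ∑ k, defect₁ deriv W ξ a a' k x * p k - defect₀ deriv W Z ξ a a' x * u := by
  have hv : ∀ f : SmoothFun U, along (X.val (x, u)).1 f x = vectorDeriv deriv ξ f x := fun f => by
    rw [h x u, vectorDeriv_apply]; simp [along]
  have hη : (X.val (x, u)).2 = a x * u + b x := by rw [h x u]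
  rw [h.prol₁, h.prol₂, hη]
  simp only [jetOpVar, hv, jetOp, defect₂, defect₁, defect₀, divOp_eq]
  simp only [sum_apply, mul_apply, add_apply, sub_apply, two_apply, zero_mul, add_zero]
  have e1 : ∑ i, ∑ j, W i j x * ∑ k, q j k * deriv i (ξ k) x
      = ∑ j, ∑ k, (∑ i, W i j x * deriv i (ξ k) x) * q j k := by
    rw [Finset.sum_comm]
    refine Finset.sum_congr rfl fun j _ => ?_
    simp only [Finset.mul_sum, Finset.sum_mul]
    rw [Finset.sum_comm]
    exact Finset.sum_congr rfl fun k _ => Finset.sum_congr rfl fun i _ => by ring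
  have e2 : ∑ i, ∑ j, W i j x * ∑ k, q i k * deriv j (ξ k) x
      = ∑ j, ∑ k, (∑ i, W i j x * deriv i (ξ k) x) * q j k := by
    rw [← e1, Finset.sum_comm]
    exact Finset.sum_congr rfl fun i _ => Finset.sum_congr rfl fun j _ => by rw [hW]
  have e3 : ∑ i, ∑ j, W i j x * ∑ k, p k * deriv i (deriv j (ξ k)) x
      = ∑ k, (∑ i, ∑ j, W i j x * deriv i (deriv j (ξ k)) x) * p k := by
    simp only [Finset.mul_sum, Finset.sum_mul]
    refine (Finset.sum_congr rfl fun i _ => Finset.sum_comm).trans (Finset.sum_comm.trans ?_)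
    exact Finset.sum_congr rfl fun k _ => Finset.sum_congr rfl fun i _ =>
      Finset.sum_congr rfl fun j _ => by ring
  have e4 : ∑ j, divCoeff deriv W j x * ∑ k, p k * deriv j (ξ k) x
      = ∑ k, (∑ j, divCoeff deriv W j x * deriv j (ξ k) x) * p k := by
    simp only [Finset.mul_sum, Finset.sum_mul]
    rw [Finset.sum_comm]
    exact Finset.sum_congr rfl fun i _ => Finset.sum_congr rfl fun j _ => by ring
  have e5 : ∑ i, ∑ j, W i j x * (p j * deriv i a x) = ∑ k, (∑ i, W i k x * deriv i a x) * p k := by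
    rw [Finset.sum_comm]
    simp only [Finset.sum_mul]
    exact Finset.sum_congr rfl fun i _ => Finset.sum_congr rfl fun j _ => by ring
  have e6 : ∑ i, ∑ j, W i j x * (p i * deriv j a x) = ∑ k, (∑ i, W i k x * deriv i a x) * p k := by
    rw [← e5, Finset.sum_comm]
    exact Finset.sum_congr rfl fun i _ => Finset.sum_congr rfl fun j _ => by rw [hW]
  simp only [mul_add, mul_sub, Finset.sum_add_distrib, Finset.sum_sub_distrib, e1, e2, e3, e4, e5,
    e6, add_mul, sub_mul, mul_assoc (a x), mul_assoc (a' x), mul_assoc (2 : ℝ), ← Finset.mul_sum]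
  simp only [← mul_assoc, ← Finset.sum_mul]
  ring
end
end PointField

/-! ### Symmetric bilinear forms -/

section LinearAlgebra

variable {n : Type*} [Fintype n] {W : n → n → ℝ}

theorem sum_sq_ne_zero (hW : ∃ i j, W i j ≠ 0) : ∑ i, ∑ j, W i j * W i j ≠ 0 := by
  obtain ⟨i, j, h⟩ := hW
  refine (Finset.sum_pos' (fun i _ => Finset.sum_nonneg fun j _ => mul_self_nonneg _)
    ⟨i, Finset.mem_univ _, Finset.sum_pos' (fun j _ => mul_self_nonneg _)
      ⟨j, Finset.mem_univ _, mul_self_pos.2 h⟩⟩).ne'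

/-- An affine function of symmetric matrices that vanishes on a hyperplane is a multiple of the
function that defines the hyperplane. -/
theorem exists_multiplier (hs : ∀ i j, W i j = W j i) (hW : ∃ i j, W i j ≠ 0)
    {M : (n → n → ℝ) → ℝ} (hM : ∀ c q q', M (q + c • q') = M q + c * M q') {N k : ℝ}
    (h : ∀ q : n → n → ℝ, (∀ i j, q i j = q j i) → ∑ i, ∑ j, W i j * q i j + k = 0 → M q + N = 0) :
    ∃ μ, N = μ * k ∧ ∀ q : n → n → ℝ, (∀ i j, q i j = q j i) →
      M q = μ * ∑ i, ∑ j, W i j * q i j := by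
  have hS := sum_sq_ne_zero hW
  set S := ∑ i, ∑ j, W i j * W i j with hSdef
  have hM0 : M 0 = 0 := by
    have := hM 1 0 0
    simp at this
    exact this
  have key : ∀ q : n → n → ℝ, (∀ i j, q i j = q j i) →
      M q - (∑ i, ∑ j, W i j * q i j + k) / S * M W + N = 0 := by
    intro q hq
    have h1 := h (q + (-((∑ i, ∑ j, W i j * q i j + k) / S)) • W)
      (fun i j => by simp [hq i j, hs i j]) (by
        have : ∑ i, ∑ j, W i j * (q + (-((∑ i, ∑ j, W i j * q i j + k) / S)) • W) i j
            = ∑ i, ∑ j, W i j * q i j + (-((∑ i, ∑ j, W i j * q i j + k) / S)) * S := by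
          rw [hSdef]
          simp only [Pi.add_apply, Pi.smul_apply, smul_eq_mul, mul_add, Finset.sum_add_distrib,
            mul_left_comm (W _ _), ← Finset.mul_sum]
        rw [this]
        field_simp
        ring)
    rw [hM] at h1
    linarith
  have hN : N = M W / S * k := by
    have := key 0 (fun _ _ => rfl)
    simp [hM0] at this
    rw [div_mul_eq_mul_div] at this ⊢
    linarith [mul_comm k (M W) ▸ this]
  refine ⟨M W / S, hN, fun q hq => ?_⟩
  have := key q hq
  rw [hN] at this
  field_simp at this ⊢
  linarith

theorem exists_quadratic_ne_zero [DecidableEq n] (hs : ∀ i j, W i j = W j i)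
    (hW : ∃ i j, W i j ≠ 0) :
    ∃ p : n → ℝ, ∑ i, ∑ j, W i j * (p i * p j) ≠ 0 := by
  by_contra! H
  obtain ⟨i, j, h⟩ := hW
  have h1 := H (Pi.single i 1)
  have h2 := H (Pi.single j 1)
  have h3 := H (Pi.single i 1 + Pi.single j 1)
  simp [Pi.single_apply, mul_add, Finset.sum_add_distrib] at h1 h2 h3
  rw [h1, h2, hs j i] at h3
  exact h (by linarith)

/-- In dimension at least two, `e eᵀ` is singular and so cannot be a nonzero multiple of a
nondegenerate `W`. -/
theorem eq_zero_of_rank_one [DecidableEq n] (hn : 1 < Fintype.card n)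
    (hs : ∀ i j, W i j = W j i) (hdet : (Matrix.of W).det ≠ 0) {e : n → ℝ} {ν : ℝ}
    (h : ∀ q : n → n → ℝ, (∀ i j, q i j = q j i) →
      ∑ i, ∑ k, q i k * (e i * e k) = ν * ∑ i, ∑ j, W i j * q i j) : e = 0 := by
  have h1 : ∀ i k, e i * e k = ν * W i k := fun i k => by
    have := h (fun a b => (Pi.single i 1 : n → ℝ) a * (Pi.single k 1 : n → ℝ) b
      + (Pi.single k 1 : n → ℝ) a * (Pi.single i 1 : n → ℝ) b) fun a b => by ring
    simp [Pi.single_apply, mul_add, add_mul, Finset.sum_add_distrib] at this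
    rw [hs k i] at this
    linarith [mul_comm (e i) (e k)]
  have : Nontrivial n := Fintype.one_lt_card_iff_nontrivial.1 hn
  have h2 : Matrix.vecMulVec e e = ν • Matrix.of W := by
    ext i k; exact h1 i k
  have h3 := congrArg Matrix.det h2
  rw [Matrix.det_vecMulVec, Matrix.det_smul] at h3
  have hν : ν = 0 := by
    rcases mul_eq_zero.1 h3.symm with h4 | h4
    · exact pow_eq_zero_iff (by omega) |>.1 h4
    · exact absurd h4 hdet
  funext i
  have := h1 i i
  rw [hν, zero_mul] at this
  exact mul_self_eq_zero.1 this

end LinearAlgebra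

namespace PointField

/-! ### Lie point symmetries -/

variable {X : PointField U}

/-- The second prolongation of `X` applied to `jetOp W Z`. -/
def jetVar (X : PointField U) (W : Fin d → Fin d → SmoothFun U) (Z : SmoothFun U) (x : U) (u : ℝ)
    (p : Coord d) (q : Fin d → Fin d → ℝ) : ℝ :=
  jetOpVar W Z (X.val (x, u)).1 x u p q
    + jetOp W Z x (X.val (x, u)).2 (X.prol₁ (x, u) p) (X.prol₂ (x, u) p q)

/-- The nonvanishing factor `1 / √|g|` can be dropped from the equation: it changes `X^{[2]} H` by a
factor and by a multiple of `H`. -/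
theorem isLieSymmetry_iff_jet {g : Coord d → Matrix (Fin d) (Fin d) ℝ} {V : Coord d → ℝ}
    (hg : IsMetric U g) (hV : ContDiffOn ℝ ∞ V U) :
    X.IsLieSymmetry g V ↔ ∀ (x : U) (u : ℝ) (p : Coord d) (q : Fin d → Fin d → ℝ),
      (∀ i j, q i j = q j i) → jetOp hg.density (hg.potential hV) x u p q = 0 →
        X.jetVar hg.density (hg.potential hV) x u p q = 0 := by
  have happ : ∀ (x : U) (u : ℝ) (p : Coord d) (q : Fin d → Fin d → ℝ),
      X.apply₂ (kgFun g V) x u p q = hg.invSqrtDet x * X.jetVar hg.density (hg.potential hV) x u p q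
        + along (X.val (x, u)).1 hg.invSqrtDet x * jetOp hg.density (hg.potential hV) x u p q :=
    fun x u p q => fderiv_kgFun hg hV x u p q _
  constructor
  · rintro ⟨lam, h⟩ x u p q hq h0
    have := h x x.2 u p q hq
    rw [happ, kgFun_eq hg hV, h0] at this
    simpa [hg.invSqrtDet_ne_zero x] using this
  · intro h
    refine ⟨fun w => X.apply₂ (kgFun g V) w.1 w.2.1 w.2.2.1 w.2.2.2 / kgFun g V w,
      fun x hx u p q hq => ?_⟩
    by_cases hk : kgFun g V (x, u, p, q) = 0
    · have hK : jetOp hg.density (hg.potential hV) ⟨x, hx⟩ u p q = 0 := by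
        have := kgFun_eq hg hV ⟨x, hx⟩ u p q
        rw [hk] at this
        exact (mul_eq_zero.1 this.symm).resolve_left (hg.invSqrtDet_ne_zero _)
      have := happ ⟨x, hx⟩ u p q
      rw [h ⟨x, hx⟩ u p q hq hK, hK] at this
      rw [this, hk]; simp
    · exact (div_mul_cancel₀ _ hk).symm

section Necessity

variable {W : Fin d → Fin d → SmoothFun U} {Z : SmoothFun U}

/-- The part of `jetVar` that is linear in the second derivatives `q`. -/
def secondVar (X : PointField U) (W : Fin d → Fin d → SmoothFun U) (x : U) (u : ℝ) (p : Coord d)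
    (q : Fin d → Fin d → ℝ) : ℝ :=
  ∑ i, ∑ j, (along (X.val (x, u)).1 (W i j) x * q i j
    + W i j x * (q i j * (pdu X.eta (x, u) - ∑ k, p k * pdu (X.xi k) (x, u))
      - ∑ k, q i k * tot j (X.xi k) (x, u) p - ∑ k, q j k * tot i (X.xi k) (x, u) p))

theorem jetVar_eq (x : U) (u : ℝ) (p : Coord d) (q : Fin d → Fin d → ℝ) :
    X.jetVar W Z x u p q = X.secondVar W x u p q + X.jetVar W Z x u p 0 := by
  simp only [jetVar, secondVar, jetOpVar, jetOp, prol₂, tot₂, Pi.zero_apply, zero_mul, mul_zero,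
    Finset.sum_const_zero, sub_zero, mul_add, mul_sub, Finset.sum_add_distrib,
    Finset.sum_sub_distrib, add_zero, mul_left_comm (_ : ℝ) (q _ _), Finset.mul_sum]
  ring

theorem secondVar_add_smul (x : U) (u : ℝ) (p : Coord d) (c : ℝ) (q q' : Fin d → Fin d → ℝ) :
    X.secondVar W x u p (q + c • q') = X.secondVar W x u p q + c * X.secondVar W x u p q' := by
  simp only [secondVar, Finset.mul_sum, ← Finset.sum_add_distrib]
  refine Finset.sum_congr rfl fun i _ => Finset.sum_congr rfl fun j _ => ?_
  simp only [Pi.add_apply, Pi.smul_apply, smul_eq_mul, add_mul, Finset.sum_add_distrib, mul_assoc,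
    ← Finset.mul_sum]
  ring

/-- The dependence of `secondVar` on the first derivatives `p`. -/
theorem secondVar_sub (hW : ∀ i j, W i j = W j i) (x : U) (u : ℝ) (p : Coord d)
    {q : Fin d → Fin d → ℝ} :
    X.secondVar W x u p q = X.secondVar W x u 0 q
      - (∑ k, p k * pdu (X.xi k) (x, u)) * (∑ i, ∑ j, W i j x * q i j)
      - 2 * ∑ i, ∑ k, q i k * ((∑ j, W i j x * p j) * pdu (X.xi k) (x, u)) := by
  have e : ∑ i, ∑ k, q i k * ((∑ j, W i j x * p j) * pdu (X.xi k) (x, u))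
      = ∑ i, ∑ j, W i j x * ∑ k, q i k * (p j * pdu (X.xi k) (x, u)) := by
    simp only [Finset.mul_sum, Finset.sum_mul]
    exact Finset.sum_congr rfl fun i _ => Finset.sum_comm.trans <|
      Finset.sum_congr rfl fun j _ => Finset.sum_congr rfl fun k _ => by ring
  have e' : ∑ i, ∑ j, W i j x * ∑ k, q j k * (p i * pdu (X.xi k) (x, u))
      = ∑ i, ∑ j, W i j x * ∑ k, q i k * (p j * pdu (X.xi k) (x, u)) := by
    rw [Finset.sum_comm]
    exact Finset.sum_congr rfl fun i _ => Finset.sum_congr rfl fun j _ => by rw [hW]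
  have e'' : (∑ k, p k * pdu (X.xi k) (x, u)) * (∑ i, ∑ j, W i j x * q i j)
      = ∑ i, ∑ j, W i j x * (q i j * ∑ k, p k * pdu (X.xi k) (x, u)) := by
    rw [mul_comm]
    simp only [Finset.sum_mul, mul_assoc]
  rw [e, e'', two_mul]
  nth_rewrite 2 [← e']
  simp only [← Finset.sum_add_distrib, ← Finset.sum_sub_distrib, secondVar]
  refine Finset.sum_congr rfl fun i _ => Finset.sum_congr rfl fun j _ => ?_
  simp only [tot, mul_add, Finset.sum_add_distrib, Pi.zero_apply, zero_mul, mul_zero,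
    Finset.sum_const_zero, mul_sub]
  ring

theorem exists_entry_ne_zero (hdet : ∀ x, (Matrix.of fun i j => W i j x).det ≠ 0) (hd : 2 ≤ d)
    (x : U) : ∃ i j, W i j x ≠ 0 := by
  by_contra! H
  have : (Matrix.of fun i j => W i j x) = 0 := by ext i j; exact H i j
  have hne : Nonempty (Fin d) := ⟨⟨0, by omega⟩⟩
  exact hdet x (by rw [this, Matrix.det_zero])

theorem jetOp_eq (x : U) (u : ℝ) (p : Coord d) (q : Fin d → Fin d → ℝ) :
    jetOp W Z x u p q = ∑ i, ∑ j, W i j x * q i j + jetOp W Z x u p 0 := by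
  simp [jetOp]; ring

/-- `X^{[2]} T` vanishes at every jet with `T = 0`, where `T = divOp deriv W Z`. -/
def PreservesEquation (X : PointField U) (W : Fin d → Fin d → SmoothFun U) (Z : SmoothFun U) :
    Prop :=
  ∀ (x : U) (u : ℝ) (p : Coord d) (q : Fin d → Fin d → ℝ), (∀ i j, q i j = q j i) →
    jetOp W Z x u p q = 0 → X.jetVar W Z x u p q = 0

theorem PreservesEquation.exists_multiplier (h : X.PreservesEquation W Z)
    (hW : ∀ i j, W i j = W j i) {x : U} (hne : ∃ i j, W i j x ≠ 0) (u : ℝ) (p : Coord d) :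
    ∃ μ, X.jetVar W Z x u p 0 = μ * jetOp W Z x u p 0 ∧
      ∀ q : Fin d → Fin d → ℝ, (∀ i j, q i j = q j i) →
        X.secondVar W x u p q = μ * ∑ i, ∑ j, W i j x * q i j := by
  refine KleinGordon.exists_multiplier (W := fun i j => W i j x) (fun i j => by rw [hW]) hne
    (fun c q q' => secondVar_add_smul x u p c q q') fun q hq h0 => ?_
  rw [← jetVar_eq]
  exact h x u p q hq (by rw [jetOp_eq]; exact h0)

/-- For first derivatives `p` with `W p = ξ_u`, comparison of the multipliers at `p` and at `0`
makes `ξ_u ξ_uᵀ` a multiple of `W`. -/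
theorem PreservesEquation.pdu_xi (h : X.PreservesEquation W Z) (hd : 2 ≤ d)
    (hW : ∀ i j, W i j = W j i) (hdet : ∀ x, (Matrix.of fun i j => W i j x).det ≠ 0) (x : U)
    (u : ℝ) (k : Fin d) : pdu (X.xi k) (x, u) = 0 := by
  have hne := exists_entry_ne_zero hdet hd x
  set e : Fin d → ℝ := fun k => pdu (X.xi k) (x, u) with he
  set M := Matrix.of fun i j => W i j x
  set p : Coord d := M⁻¹.mulVec e with hp
  have hpe : ∀ i, ∑ j, W i j x * p j = e i := fun i => by
    have : M.mulVec p = e := by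
      rw [hp, Matrix.mulVec_mulVec, Matrix.mul_nonsing_inv _ (isUnit_iff_ne_zero.2 (hdet x)),
        Matrix.one_mulVec]
    exact congrFun this i
  obtain ⟨μ, -, hμ⟩ := h.exists_multiplier hW hne u p
  obtain ⟨μ₀, -, hμ₀⟩ := h.exists_multiplier hW hne u 0
  have key : e = 0 := by
    refine eq_zero_of_rank_one (W := fun i j => W i j x) (by simp; omega)
      (fun i j => by rw [hW]) (hdet x) (ν := (μ₀ - μ - ∑ k, p k * e k) / 2) fun q hq => ?_
    have h1 := secondVar_sub (X := X) hW x u p (q := q)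
    rw [hμ q hq, hμ₀ q hq] at h1
    simp only [hpe] at h1
    change _ = _ - (∑ k, p k * e k) * _ - 2 * ∑ i, ∑ k, q i k * (e i * e k) at h1
    linarith
  exact congrFun key k

/-- For `ξ = ξ(x)`, the part of `jetVar` quadratic in the first derivatives comes from `η_uu`
alone. -/
theorem even_part_jetVar {ξ : Fin d → SmoothFun U}
    (hξ : ∀ k (x : U) (u : ℝ), X.xi k (x, u) = (0 : SmoothFun U) x * u + ξ k x) (x : U) (u : ℝ)
    (p : Coord d) :
    X.jetVar W Z x u p 0 + X.jetVar W Z x u (-p) 0 - 2 * X.jetVar W Z x u 0 0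
      = 2 * pdu (pdu X.eta) (x, u) * ∑ i, ∑ j, W i j x * (p i * p j) := by
  have h₁ : ∀ i, X.prol₁ (x, u) p i + X.prol₁ (x, u) (-p) i - 2 * X.prol₁ (x, u) 0 i = 0 := by
    intro i
    simp [prol₁, tot, pdx_of_affine (hξ _), pdu_of_affine (hξ _)]
    ring
  have h₂ : ∀ i j, X.prol₂ (x, u) p 0 i j + X.prol₂ (x, u) (-p) 0 i j
      - 2 * X.prol₂ (x, u) 0 0 i j = 2 * pdu (pdu X.eta) (x, u) * (p i * p j) := by
    intro i j
    simp only [prol₂, tot₂_of_affine (hξ _)]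
    simp [tot₂]
    ring
  have e : X.jetVar W Z x u p 0 + X.jetVar W Z x u (-p) 0 - 2 * X.jetVar W Z x u 0 0
      = ∑ i, ∑ j, W i j x * (X.prol₂ (x, u) p 0 i j + X.prol₂ (x, u) (-p) 0 i j
          - 2 * X.prol₂ (x, u) 0 0 i j)
        + ∑ j, divCoeff deriv W j x * (X.prol₁ (x, u) p j + X.prol₁ (x, u) (-p) j
          - 2 * X.prol₁ (x, u) 0 j) := by
    simp only [jetVar, jetOpVar, jetOp, mul_add, mul_sub, Finset.sum_add_distrib,
      Finset.sum_sub_distrib, mul_left_comm _ (2 : ℝ), ← Finset.mul_sum, Pi.neg_apply, mul_neg,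
      Finset.sum_neg_distrib, Pi.zero_apply, mul_zero, Finset.sum_const_zero]
    ring
  rw [e]
  simp only [h₁, h₂, mul_left_comm (W _ _ x), ← Finset.mul_sum, mul_zero, Finset.sum_const_zero,
    add_zero]

theorem PreservesEquation.isAffine (h : X.PreservesEquation W Z) (hd : 2 ≤ d)
    (hW : ∀ i j, W i j = W j i) (hdet : ∀ x, (Matrix.of fun i j => W i j x).det ≠ 0) :
    ∃ ξ a b, X.IsAffine ξ a b := by
  have hξ : ∀ k (x : U) (u : ℝ), X.xi k (x, u)
      = (0 : SmoothFun U) x * u + fibreAt (X.xi k) (X.contDiffOn_xi k) 0 x := fun k x u => by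
    have := eq_of_pdu_eq (X.contDiffOn_xi k) x (c₁ := 0) (c₀ := 0)
      (fun t => by rw [h.pdu_xi hd hW hdet]; simp) u
    simpa [fibreAt_apply] using this
  have huu : ∀ (x : U) (u : ℝ), pdu (pdu X.eta) (x, u) = 0 := by
    intro x u
    have hne := exists_entry_ne_zero hdet hd x
    obtain ⟨p, hp⟩ := exists_quadratic_ne_zero (W := fun i j => W i j x)
      (fun i j => by rw [hW]) hne
    have hμ : ∀ p, ∃ μ, X.jetVar W Z x u p 0 = μ * jetOp W Z x u p 0 ∧
        X.secondVar W x u 0 (fun i j => W i j x) = μ * ∑ i, ∑ j, W i j x * W i j x := by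
      intro p
      obtain ⟨μ, h1, h2⟩ := h.exists_multiplier hW hne u p
      refine ⟨μ, h1, ?_⟩
      rw [← h2 (fun i j => W i j x) (fun i j => by rw [hW]), secondVar_sub hW x u p]
      simp [h.pdu_xi hd hW hdet]
    have hS := sum_sq_ne_zero hne
    obtain ⟨μ, h1, h1'⟩ := hμ p
    obtain ⟨μ', h2, h2'⟩ := hμ (-p)
    obtain ⟨μ'', h3, h3'⟩ := hμ 0
    have e1 : μ' = μ := mul_right_cancel₀ hS (h2'.symm.trans h1')
    have e2 : μ'' = μ := mul_right_cancel₀ hS (h3'.symm.trans h1')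
    have key := even_part_jetVar (W := W) (Z := Z) hξ x u p
    rw [h1, h2, h3, e1, e2] at key
    have e3 : jetOp W Z x u p 0 + jetOp W Z x u (-p) 0 - 2 * jetOp W Z x u 0 0 = 0 := by
      simp [jetOp]; ring
    have e4 : 2 * pdu (pdu X.eta) (x, u) * ∑ i, ∑ j, W i j x * (p i * p j) = 0 := by
      rw [← key]; linear_combination μ * e3
    simpa [hp] using e4
  have hu : ∀ (x : U) (u : ℝ), pdu X.eta (x, u) = pdu X.eta (x, 0) := fun x u => by
    simpa using eq_of_pdu_eq (contDiffOn_pdu X.contDiffOn_eta) x (c₁ := 0) (c₀ := 0)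
      (fun t => by simp [huu]) u
  exact ⟨_, _, _, isAffine_of_pdu (fun k x u => h.pdu_xi hd hW hdet x u k) hu⟩

theorem PreservesEquation.intertwines (h : X.PreservesEquation W Z) (hd : 2 ≤ d)
    (hW : ∀ i j, W i j = W j i) (hdet : ∀ x, (Matrix.of fun i j => W i j x).det ≠ 0)
    {ξ : Fin d → SmoothFun U} {a b : SmoothFun U} (hX : X.IsAffine ξ a b) :
    ∃ a', Intertwines deriv W Z ξ a a' ∧ divOp deriv W Z b = 0 := by
  obtain ⟨s, hs⟩ := exists_mul_eq_one (∑ i, ∑ j, W i j * W i j) fun x => by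
    simpa using sum_sq_ne_zero (exists_entry_ne_zero hdet hd x)
  -- The multiplier of the equation is `a'`, so `a'` is fixed by a contraction of the second-order
  -- condition with `W`; this expresses it by smooth functions.
  set R := ∑ j, ∑ k, defect₂ deriv W ξ a a j k * W j k with hR
  set a' := a - s * R with ha'
  have hR' : ∑ j, ∑ k, defect₂ deriv W ξ a a' j k * W j k = 0 := by
    have e : ∑ j, ∑ k, defect₂ deriv W ξ a a' j k * W j k
        = R + (a' - a) * ∑ i, ∑ j, W i j * W i j := by
      simp only [hR, Finset.mul_sum, ← Finset.sum_add_distrib, defect₂]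
      exact Finset.sum_congr rfl fun i _ => Finset.sum_congr rfl fun j _ => by ring
    rw [e, ha']
    linear_combination -R * hs
  have key : ∀ (x : U) (u : ℝ) (p : Coord d),
      (∀ q : Fin d → Fin d → ℝ, (∀ i j, q i j = q j i) →
        ∑ j, ∑ k, defect₂ deriv W ξ a a' j k x * q j k = 0) ∧
      divOp deriv W Z b x - ∑ k, defect₁ deriv W ξ a a' k x * p k
        - defect₀ deriv W Z ξ a a' x * u = 0 := by
    intro x u p
    have hne := exists_entry_ne_zero hdet hd x
    obtain ⟨μ, h1, h2⟩ := h.exists_multiplier hW hne u p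
    have e0 := jetOp_affine (Z := Z) hW hX a' x u p 0
    simp only [Pi.zero_apply, mul_zero, Finset.sum_const_zero, sub_zero] at e0
    have e1 : ∀ q : Fin d → Fin d → ℝ, X.secondVar W x u p q = a' x * ∑ i, ∑ j, W i j x * q i j
        - ∑ j, ∑ k, defect₂ deriv W ξ a a' j k x * q j k := fun q => by
      have e2 := jetOp_affine (Z := Z) hW hX a' x u p q
      have e3 := jetVar_eq (X := X) (W := W) (Z := Z) x u p q
      rw [jetOp_eq x u p q] at e2
      unfold jetVar at e3
      linarith
    have hμ : μ = a' x := by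
      have e4 := e1 fun i j => W i j x
      rw [h2 _ fun i j => by rw [hW]] at e4
      have e5 : ∑ j, ∑ k, defect₂ deriv W ξ a a' j k x * W j k x = 0 := by
        simpa using congrArg (fun f : SmoothFun U => f x) hR'
      rw [e5, sub_zero] at e4
      exact mul_right_cancel₀ (sum_sq_ne_zero hne) e4
    refine ⟨fun q hq => ?_, ?_⟩
    · have e6 := e1 q
      rw [h2 q hq, hμ] at e6
      linarith
    · rw [hμ] at h1
      unfold jetVar at h1
      linarith
  refine ⟨a', intertwines_of_defect deriv_comm hW (fun j k => ?_) (fun k => ?_) ?_, ?_⟩ <;>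
    refine SmoothFun.ext_apply fun x => ?_
  · have := (key x 0 0).1 (fun a b => (Pi.single j 1 : Fin d → ℝ) a * (Pi.single k 1 : Fin d → ℝ) b
      + (Pi.single k 1 : Fin d → ℝ) a * (Pi.single j 1 : Fin d → ℝ) b) fun a b => by ring
    simpa [Pi.single_apply, mul_add, Finset.sum_add_distrib] using this
  · have h0 := (key x 0 0).2
    have h1 := (key x 0 (Pi.single k 1)).2
    simp [Pi.single_apply] at h0 h1
    simpa [h0] using h1
  · have h0 := (key x 0 0).2
    have h1 := (key x 1 0).2
    simp at h0 h1
    simpa [h0] using h1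
  · simpa using (key x 0 0).2

theorem IsAffine.preservesEquation (hW : ∀ i j, W i j = W j i)
    {ξ : Fin d → SmoothFun U} {a a' b : SmoothFun U} (hX : X.IsAffine ξ a b)
    (h : Intertwines deriv W Z ξ a a') (hb : divOp deriv W Z b = 0) : X.PreservesEquation W Z := by
  intro x u p q hq h0
  obtain ⟨h₂, h₁, h₀⟩ := h.defect deriv_comm hW deriv_coord
  rw [jetVar, jetOp_affine hW hX a' x u p q, h0, hb, h₀]
  have e : ∑ j, ∑ k, defect₂ deriv W ξ a a' j k x * q j k = 0 :=
    sum_mul_eq_zero_of_symm (fun j k => by rw [← add_apply, h₂, zero_apply]) hq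
  rw [e]
  simp [h₁]

end Necessity
end PointField

/-! ### Noether point symmetries -/

/-- A nonzero quadratic form times a linear form vanishes identically only if the linear form is
zero. -/
theorem eq_zero_of_quadratic_mul_linear {n : Type*} [Fintype n] [DecidableEq n] {W : n → n → ℝ}
    (hs : ∀ i j, W i j = W j i) (hW : ∃ i j, W i j ≠ 0) {e : n → ℝ}
    (h : ∀ p : n → ℝ, (∑ i, ∑ j, W i j * (p i * p j)) * ∑ i, p i * e i = 0) : e = 0 := by
  by_contra he
  obtain ⟨p, hp⟩ := exists_quadratic_ne_zero hs hW
  have hpe : ∑ i, p i * e i = 0 := (mul_eq_zero.1 (h p)).resolve_left hp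
  have hee : ∑ i, e i * e i ≠ 0 := fun h0 => he (funext fun i => mul_self_eq_zero.1
    ((Finset.sum_eq_zero_iff_of_nonneg fun i _ => mul_self_nonneg _).1 h0 i (Finset.mem_univ i)))
  have key : ∀ t : ℝ, t ≠ 0 → ∑ i, ∑ j, W i j * (p i * p j)
      + t * ∑ i, ∑ j, W i j * (p i * e j + e i * p j)
      + t ^ 2 * ∑ i, ∑ j, W i j * (e i * e j) = 0 := by
    intro t ht
    have h1 := h (p + t • e)
    have h2 : ∑ i, (p + t • e) i * e i = t * ∑ i, e i * e i := by
      simp [add_mul, Finset.sum_add_distrib, hpe, mul_assoc, Finset.mul_sum]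
    rw [h2] at h1
    rw [← (mul_eq_zero.1 h1).resolve_right (mul_ne_zero ht hee)]
    simp only [Finset.mul_sum, ← Finset.sum_add_distrib]
    refine Finset.sum_congr rfl fun i _ => Finset.sum_congr rfl fun j _ => ?_
    simp
    ring
  have h1 := key 1 one_ne_zero
  have h2 := key (-1) (by norm_num)
  have h3 := key 2 two_ne_zero
  exact hp (by linarith)

namespace PointField

variable {X : PointField U}

/-- The difference of the two sides of the Noether condition `X^{[1]} L + L D_i ξ^i = D_i A^i`, for
`L = ½ W i j u_i u_j - ½ Z u²`. -/
def noetherDefect (X : PointField U) (W : Fin d → Fin d → SmoothFun U) (Z : SmoothFun U)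
    (A : J0 d → Coord d) (x : U) (u : ℝ) (p : Coord d) : ℝ :=
  1 / 2 * ∑ i, ∑ j, along (X.val (x, u)).1 (W i j) x * p i * p j
    + ∑ i, ∑ j, W i j x * p i * X.prol₁ (x, u) p j
    - 1 / 2 * along (X.val (x, u)).1 Z x * u ^ 2 - Z x * u * X.eta (x, u)
    + (1 / 2 * ∑ i, ∑ j, W i j x * p i * p j - 1 / 2 * Z x * u ^ 2) *
      ∑ i, tot i (X.xi i) (x, u) p
    - ∑ i, tot i (fun z => A z i) (x, u) p

theorem isNoetherSymmetry_iff_jet {g : Coord d → Matrix (Fin d) (Fin d) ℝ} {V : Coord d → ℝ}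
    (hg : IsMetric U g) (hV : ContDiffOn ℝ ∞ V U) :
    X.IsNoetherSymmetry g V ↔ ∃ A : J0 d → Coord d,
      ContDiffOn ℝ ∞ A ((U : Set (Coord d)) ×ˢ Set.univ) ∧
      ∀ (x : U) (u : ℝ) (p : Coord d),
        X.noetherDefect hg.density (hg.potential hV) A x u p = 0 := by
  refine exists_congr fun A => and_congr_right fun _ => ?_
  refine Iff.trans ⟨fun h (x : U) => h x x.2, fun h x hx => h ⟨x, hx⟩⟩
    (forall_congr' fun x => forall_congr' fun u => forall_congr' fun p => ?_)
  rw [← sub_eq_zero, apply₁, fderiv_kgLagrangian hg hV, kgLagrangian_eq hg hV]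
  rfl

variable {W : Fin d → Fin d → SmoothFun U} {Z : SmoothFun U}

/-- The part of `noetherDefect` that is homogeneous of degree two in the first derivatives. -/
def noetherQuadratic (X : PointField U) (W : Fin d → Fin d → SmoothFun U) (x : U) (u : ℝ)
    (p : Coord d) : ℝ :=
  1 / 2 * ∑ i, ∑ j, along (X.val (x, u)).1 (W i j) x * (p i * p j)
    + ∑ i, ∑ j, W i j x * (p i * (p j * pdu X.eta (x, u) - ∑ k, p k * pdx j (X.xi k) (x, u)))
    + 1 / 2 * (∑ i, ∑ j, W i j x * (p i * p j)) * ∑ i, pdx i (X.xi i) (x, u)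

/-- `noetherDefect` is a cubic polynomial in the first derivatives; its homogeneous parts appear as
the coefficients of the powers of `t`. -/
theorem noetherDefect_smul (A : J0 d → Coord d) (x : U) (u : ℝ) (p : Coord d) (t : ℝ) :
    X.noetherDefect W Z A x u (t • p)
      = (-(1 / 2 * along (X.val (x, u)).1 Z x * u ^ 2) - Z x * u * X.eta (x, u)
          - 1 / 2 * Z x * u ^ 2 * ∑ i, pdx i (X.xi i) (x, u)
          - ∑ i, pdx i (fun z => A z i) (x, u))
        + t * (∑ i, ∑ j, W i j x * (p i * pdx j X.eta (x, u))
          - 1 / 2 * Z x * u ^ 2 * ∑ i, p i * pdu (X.xi i) (x, u)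
          - ∑ i, p i * pdu (fun z => A z i) (x, u))
        + t ^ 2 * X.noetherQuadratic W x u p
        + t ^ 3 * (-1 / 2 * ((∑ i, ∑ j, W i j x * (p i * p j))
          * ∑ k, p k * pdu (X.xi k) (x, u))) := by
  have h : ∀ i j, W i j x * (t * p i) * X.prol₁ (x, u) (t • p) j
      = t * (W i j x * (p i * pdx j X.eta (x, u)))
        + t ^ 2 * (W i j x * (p i * (p j * pdu X.eta (x, u) - ∑ k, p k * pdx j (X.xi k) (x, u))))
        - t ^ 3 * (W i j x * (p i * p j) * ∑ k, p k * pdu (X.xi k) (x, u)) := by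
    intro i j
    have e : ∑ k, t * p k * (pdx j (X.xi k) (x, u) + t * p j * pdu (X.xi k) (x, u))
        = t * ∑ k, p k * pdx j (X.xi k) (x, u)
          + t ^ 2 * p j * ∑ k, p k * pdu (X.xi k) (x, u) := by
      simp only [Finset.mul_sum, ← Finset.sum_add_distrib]
      exact Finset.sum_congr rfl fun k _ => by ring
    simp only [prol₁, tot, Pi.smul_apply, smul_eq_mul, e]
    ring
  have h1 : ∀ i j (c : ℝ), c * (t * p i) * (t * p j) = t ^ 2 * (c * (p i * p j)) :=
    fun i j c => by ring
  have h2 : ∀ i (c : ℝ), t * p i * c = t * (p i * c) := fun i c => by ring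
  simp only [noetherDefect, noetherQuadratic, Pi.smul_apply, smul_eq_mul, h, h1, tot, h2,
    Finset.sum_add_distrib, Finset.sum_sub_distrib, ← Finset.mul_sum, ← Finset.sum_mul]
  ring

theorem noetherDefect_eq_zero_iff (A : J0 d → Coord d) (x : U) (u : ℝ) :
    (∀ p, X.noetherDefect W Z A x u p = 0) ↔
      -(1 / 2 * along (X.val (x, u)).1 Z x * u ^ 2) - Z x * u * X.eta (x, u)
          - 1 / 2 * Z x * u ^ 2 * ∑ i, pdx i (X.xi i) (x, u)
          - ∑ i, pdx i (fun z => A z i) (x, u) = 0 ∧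
      ∀ p : Coord d, ∑ i, ∑ j, W i j x * (p i * pdx j X.eta (x, u))
          - 1 / 2 * Z x * u ^ 2 * ∑ i, p i * pdu (X.xi i) (x, u)
          - ∑ i, p i * pdu (fun z => A z i) (x, u) = 0 ∧
        X.noetherQuadratic W x u p = 0 ∧
        (∑ i, ∑ j, W i j x * (p i * p j)) * ∑ k, p k * pdu (X.xi k) (x, u) = 0 := by
  constructor
  · intro h
    have key := fun (p : Coord d) (t : ℝ) =>
      (noetherDefect_smul (X := X) (W := W) (Z := Z) A x u p t).symm.trans (h (t • p))
    refine ⟨by simpa using key 0 0, fun p => ?_⟩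
    have h0 := key p 0
    have h1 := key p 1
    have h2 := key p (-1)
    have h3 := key p 2
    refine ⟨by linarith, by linarith, by linarith⟩
  · rintro ⟨h0, h⟩ p
    obtain ⟨h1, h2, h3⟩ := h p
    have := noetherDefect_smul (X := X) (W := W) (Z := Z) A x u p 1
    rw [one_smul, h0, h1, h2, h3] at this
    rw [this]; ring

/-- For an affine field, the quadratic part of the Noether condition is the second-order part of the
intertwining relation with `a' = -a - ∂_k ξ^k`. -/
theorem IsAffine.noetherQuadratic (hW : ∀ i j, W i j = W j i) {ξ : Fin d → SmoothFun U}
    {a b : SmoothFun U} (h : X.IsAffine ξ a b) (x : U) (u : ℝ) (p : Coord d) :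
    X.noetherQuadratic W x u p
      = -1 / 2 * ∑ j, ∑ k, defect₂ deriv W ξ a (-a - divergence deriv ξ) j k x * (p j * p k) := by
  have hv : ∀ f : SmoothFun U, along (X.val (x, u)).1 f x = vectorDeriv deriv ξ f x := fun f => by
    rw [h x u, vectorDeriv_apply]; simp [along]
  have e1 : ∑ i, ∑ j, W i j x * (p i * ∑ k, p k * deriv j (ξ k) x)
      = ∑ j, ∑ k, (∑ i, W i j x * deriv i (ξ k) x) * (p j * p k) := by
    simp only [Finset.mul_sum, Finset.sum_mul]
    refine Finset.sum_congr rfl fun i _ => Finset.sum_comm.trans ?_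
    exact Finset.sum_congr rfl fun k _ => Finset.sum_congr rfl fun j _ => by rw [hW]; ring
  have e2 : divergence deriv ξ x = ∑ i, deriv i (ξ i) x := by rw [divergence, sum_apply]
  simp only [PointField.noetherQuadratic, hv, pdu_of_affine h.eta, pdx_of_affine (h.xi _), defect₂,
    map_zero, zero_apply, zero_mul, zero_add, sub_apply, add_apply, neg_apply, mul_apply, two_apply,
    sum_apply]
  rw [← e2]
  simp only [mul_sub, sub_mul, add_mul, Finset.sum_sub_distrib, Finset.sum_add_distrib, e1,
    mul_assoc, ← Finset.mul_sum, neg_mul, Finset.sum_neg_distrib]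
  have e3 : ∑ i, ∑ j, W i j x * (p i * (p j * a x)) = a x * ∑ i, ∑ j, W i j x * (p i * p j) := by
    simp only [Finset.mul_sum]
    exact Finset.sum_congr rfl fun k _ => Finset.sum_congr rfl fun j _ => by ring
  rw [e3]
  ring

theorem pdx_eq_deriv_fibreAt {F : J0 d → ℝ}
    (hF : ContDiffOn ℝ ∞ F ((U : Set (Coord d)) ×ˢ Set.univ)) (i : Fin d) (x : U) (u : ℝ) :
    pdx i F (x, u) = deriv i (fibreAt F hF u) x := by
  have h : DifferentiableAt ℝ F ((x : Coord d), u) := (hF.contDiffAt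
    ((PointField.isOpen_domain U).mem_nhds ⟨x.2, trivial⟩)).differentiableAt (by simp)
  rw [deriv_apply_of_eq (F := fun y => F (y, u)) i (fun _ => rfl), pd, pdx]
  have h2 : HasFDerivAt (fun y : Coord d => (y, u)) (ContinuousLinearMap.inl ℝ (Coord d) ℝ) x :=
    hasFDerivAt_prodMk_left _ _
  exact (congrArg (fun T => T (Pi.single i 1)) (h.hasFDerivAt.comp (x : Coord d) h2).fderiv).symm

/-- The Noether condition for `X` with gauge vector `A`. -/
def PreservesLagrangian (X : PointField U) (W : Fin d → Fin d → SmoothFun U) (Z : SmoothFun U)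
    (A : J0 d → Coord d) : Prop :=
  ∀ (x : U) (u : ℝ) (p : Coord d), X.noetherDefect W Z A x u p = 0

theorem PreservesLagrangian.isAffine {A : J0 d → Coord d} (h : X.PreservesLagrangian W Z A)
    (hW : ∀ i j, W i j = W j i) (hne : ∀ x, ∃ i j, W i j x ≠ 0) : ∃ ξ a b, X.IsAffine ξ a b := by
  have hξ : ∀ k (x : U) (u : ℝ), pdu (X.xi k) (x, u) = 0 := fun k x u => by
    have h1 := (noetherDefect_eq_zero_iff A x u).1 (h x u)
    exact congrFun (eq_zero_of_quadratic_mul_linear (W := fun i j => W i j x)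
      (e := fun k => pdu (X.xi k) (x, u)) (fun i j => by rw [hW]) (hne x) fun p => (h1.2 p).2.2) k
  refine ⟨_, _, _, isAffine_of_pdu hξ fun x u => ?_⟩
  have hx : ∀ k (x : U) (u : ℝ), X.xi k (x, u)
      = (0 : SmoothFun U) x * u + fibreAt (X.xi k) (X.contDiffOn_xi k) 0 x := fun k x u => by
    have := eq_of_pdu_eq (X.contDiffOn_xi k) x (c₁ := 0) (c₀ := 0)
      (fun t => by rw [hξ]; simp) u
    simpa [fibreAt_apply] using this
  obtain ⟨p, hp⟩ := exists_quadratic_ne_zero (W := fun i j => W i j x)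
    (fun i j => by rw [hW]) (hne x)
  have h1 := (((noetherDefect_eq_zero_iff A x u).1 (h x u)).2 p).2.1
  have h2 := (((noetherDefect_eq_zero_iff A x 0).1 (h x 0)).2 p).2.1
  have hv : (X.val (x, u)).1 = (X.val (x, 0)).1 := funext fun k => by
    have h3 := hx k x u
    rw [← hx k x 0 |>.trans (by simp : _ = (0 : SmoothFun U) x * u + _)] at h3
    exact h3
  have h4 : X.noetherQuadratic W x u p - X.noetherQuadratic W x 0 p
      = (pdu X.eta (x, u) - pdu X.eta (x, 0)) * ∑ i, ∑ j, W i j x * (p i * p j) := by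
    simp only [noetherQuadratic, hv, pdx_of_affine (hx _), map_zero, zero_apply, zero_mul, zero_add]
    have e : ∀ c, ∑ i, ∑ j, W i j x * (p i * (p j * c)) = c * ∑ i, ∑ j, W i j x * (p i * p j) := by
      intro c
      simp only [Finset.mul_sum]
      exact Finset.sum_congr rfl fun k _ => Finset.sum_congr rfl fun j _ => by ring
    simp only [mul_sub, Finset.sum_sub_distrib, e]
    ring
  rw [h1, h2, sub_zero] at h4
  exact sub_eq_zero.1 ((mul_eq_zero.1 h4.symm).resolve_right hp)

/-- For `a' = -a - ∂_k ξ^k` the first-order part of the intertwining relation is a consequence of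
the second-order part, by `sum_deriv_defect₂`. -/
theorem intertwines_of_variational_defect (hW : ∀ i j, W i j = W j i) {ξ : Fin d → SmoothFun U}
    {a : SmoothFun U}
    (h₂ : ∀ j k, defect₂ deriv W ξ a (-a - divergence deriv ξ) j k
      + defect₂ deriv W ξ a (-a - divergence deriv ξ) k j = 0)
    (h₀ : defect₀ deriv W Z ξ a (-a - divergence deriv ξ) = 0) :
    Intertwines deriv W Z ξ a (-a - divergence deriv ξ) := by
  refine intertwines_of_defect deriv_comm hW h₂ (fun k => ?_) h₀
  have h := sum_deriv_defect₂ (ξ := ξ) (a := a) (a' := -a - divergence deriv ξ) deriv_comm hW k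
  have e : divergence deriv ξ + a + (-a - divergence deriv ξ) = 0 := by ring
  simp only [h₂, e, map_zero, mul_zero, Finset.sum_const_zero, add_zero] at h
  refine SmoothFun.ext_apply fun x => ?_
  simpa using congrArg (fun f : SmoothFun U => f x) h.symm

theorem PreservesLagrangian.intertwines {A : J0 d → Coord d} (h : X.PreservesLagrangian W Z A)
    (hA : ContDiffOn ℝ ∞ A ((U : Set (Coord d)) ×ˢ Set.univ)) (hW : ∀ i j, W i j = W j i)
    {ξ : Fin d → SmoothFun U} {a b : SmoothFun U} (hX : X.IsAffine ξ a b) :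
    Intertwines deriv W Z ξ a (-a - divergence deriv ξ) ∧ divOp deriv W Z b = 0 := by
  have hv : ∀ (f : SmoothFun U) (x : U) u,
      along (X.val (x, u)).1 f x = vectorDeriv deriv ξ f x := fun f x u => by
    rw [hX x u, vectorDeriv_apply]; simp [along]
  have h₂ : ∀ j k, defect₂ deriv W ξ a (-a - divergence deriv ξ) j k
      + defect₂ deriv W ξ a (-a - divergence deriv ξ) k j = 0 := by
    intro j k
    refine SmoothFun.ext_apply fun x => ?_
    have key : ∀ p : Coord d, ∑ j, ∑ k,
        defect₂ deriv W ξ a (-a - divergence deriv ξ) j k x * (p j * p k) = 0 := fun p => by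
      have := (((noetherDefect_eq_zero_iff A x 0).1 (h x 0)).2 p).2.1
      rw [hX.noetherQuadratic hW] at this
      linarith
    have h1 := key (Pi.single j 1)
    have h2 := key (Pi.single k 1)
    have h3 := key (Pi.single j 1 + Pi.single k 1)
    simp [Pi.single_apply, mul_add, Finset.sum_add_distrib] at h1 h2 h3
    rw [h1, h2] at h3
    simpa [add_comm] using h3
  have hAi : ∀ i, ContDiffOn ℝ ∞ (fun z => A z i) ((U : Set (Coord d)) ×ˢ Set.univ) :=
    fun i => contDiffOn_pi.1 hA i
  -- The part linear in the first derivatives determines `∂_u A^i`, hence `A^i` up to its value at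
  -- `u = 0`, which drops out of the part of degree zero.
  have hAu : ∀ i (x : U) (u : ℝ), pdu (fun z => A z i) (x, u)
      = (∑ j, W i j * deriv j a) x * u + (∑ j, W i j * deriv j b) x := by
    intro i x u
    have := (((noetherDefect_eq_zero_iff A x u).1 (h x u)).2 (Pi.single i 1)).1
    simp [pdu_of_affine (hX.xi _), pdx_of_affine hX.eta, Pi.single_apply, mul_add,
      Finset.sum_add_distrib] at this
    simp [Finset.sum_mul]
    simp only [mul_assoc]
    linarith
  have hAe : ∀ i (u : ℝ), fibreAt (fun z => A z i) (hAi i) u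
      = (u ^ 2 / 2) • (∑ j, W i j * deriv j a) + u • (∑ j, W i j * deriv j b)
        + fibreAt (fun z => A z i) (hAi i) 0 := fun i u => SmoothFun.ext_apply fun x => by
    have := eq_of_pdu_eq (hAi i) x (hAu i x) u
    simp only [add_apply, smul_apply, fibreAt_apply]
    linarith
  have hAx : ∀ (x : U) (u : ℝ), ∑ i, pdx i (fun z => A z i) (x, u)
      = u ^ 2 / 2 * divOp deriv W 0 a x + u * divOp deriv W 0 b x
        + ∑ i, deriv i (fibreAt (fun z => A z i) (hAi i) 0) x := by
    intro x u
    have e : ∀ i, pdx i (fun z => A z i) (x, u) = u ^ 2 / 2 * deriv i (∑ j, W i j * deriv j a) x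
        + u * deriv i (∑ j, W i j * deriv j b) x
        + deriv i (fibreAt (fun z => A z i) (hAi i) 0) x := fun i => by
      rw [pdx_eq_deriv_fibreAt (hAi i), hAe]
      simp only [map_add, Derivation.map_smul, add_apply, smul_apply]
    simp only [e, Finset.sum_add_distrib, ← Finset.mul_sum, divOp_apply, zero_mul, add_zero,
      sum_apply]
  have key : ∀ (x : U) (u : ℝ), -(1 / 2 * vectorDeriv deriv ξ Z x * u ^ 2)
      - Z x * u * (a x * u + b x) - 1 / 2 * Z x * u ^ 2 * divergence deriv ξ x
      - (u ^ 2 / 2 * divOp deriv W 0 a x + u * divOp deriv W 0 b x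
        + ∑ i, deriv i (fibreAt (fun z => A z i) (hAi i) 0) x) = 0 := fun x u => by
    have := ((noetherDefect_eq_zero_iff A x u).1 (h x u)).1
    rw [hAx, hv, hX.eta] at this
    simp only [pdx_of_affine (hX.xi _), map_zero, zero_apply, zero_mul, zero_add] at this
    rw [divergence, sum_apply]
    exact this
  have hT : ∀ f x, divOp deriv W Z f x = divOp deriv W 0 f x + Z x * f x := fun f x => by
    simp [divOp_apply]
  refine ⟨intertwines_of_variational_defect hW h₂ ?_, ?_⟩ <;> refine SmoothFun.ext_apply fun x => ?_
  · have h1 := key x 0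
    have h2 := key x 1
    have h3 := key x (-1)
    simp only [defect₀, sub_apply, mul_apply, neg_apply, zero_apply, hT]
    linarith
  · have h2 := key x 1
    have h3 := key x (-1)
    rw [hT, zero_apply]
    linarith

theorem IsAffine.exists_preservesLagrangian (hW : ∀ i j, W i j = W j i)
    {ξ : Fin d → SmoothFun U} {a b : SmoothFun U} (hX : X.IsAffine ξ a b)
    (h : Intertwines deriv W Z ξ a (-a - divergence deriv ξ)) (hb : divOp deriv W Z b = 0) :
    ∃ A : J0 d → Coord d, ContDiffOn ℝ ∞ A ((U : Set (Coord d)) ×ˢ Set.univ) ∧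
      X.PreservesLagrangian W Z A := by
  set f : Fin d → SmoothFun U := fun i => ∑ j, W i j * deriv j a with hf
  set g : Fin d → SmoothFun U := fun i => ∑ j, W i j * deriv j b with hg
  have hv : ∀ (f : SmoothFun U) (x : U) u,
      along (X.val (x, u)).1 f x = vectorDeriv deriv ξ f x := fun f x u => by
    rw [hX x u, vectorDeriv_apply]; simp [along]
  have hext : ∀ f : SmoothFun U, ContDiffOn ℝ ∞ (fun z : J0 d => f.extend z.1)
      ((U : Set (Coord d)) ×ˢ Set.univ) := fun f =>
    f.contDiffOn_extend.comp contDiffOn_fst fun z hz => hz.1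
  set A : J0 d → Coord d := fun z i => z.2 ^ 2 / 2 * (f i).extend z.1 + z.2 * (g i).extend z.1
    with hAdef
  have hAi : ∀ i, ContDiffOn ℝ ∞ (fun z => A z i) ((U : Set (Coord d)) ×ˢ Set.univ) := fun i =>
    (((contDiffOn_snd.pow 2).div_const 2).mul (hext _)).add (contDiffOn_snd.mul (hext _))
  refine ⟨A, contDiffOn_pi.2 hAi, fun x u => (noetherDefect_eq_zero_iff A x u).2 ?_⟩
  obtain ⟨h₂, -, h₀⟩ := h.defect deriv_comm hW deriv_coord
  have hT : ∀ f x, divOp deriv W Z f x = divOp deriv W 0 f x + Z x * f x := fun f x => by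
    simp [divOp_apply]
  have hAe : ∀ i, fibreAt (fun z => A z i) (hAi i) u = (u ^ 2 / 2) • f i + u • g i := fun i =>
    SmoothFun.ext_apply fun y => by
      simp only [fibreAt_apply, add_apply, smul_apply, hAdef, extend_apply]
  have hAx : ∑ i, pdx i (fun z => A z i) (x, u)
      = u ^ 2 / 2 * divOp deriv W 0 a x + u * divOp deriv W 0 b x := by
    have e : ∀ i, pdx i (fun z => A z i) (x, u)
        = u ^ 2 / 2 * deriv i (f i) x + u * deriv i (g i) x := fun i => by
      rw [pdx_eq_deriv_fibreAt (hAi i), hAe]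
      simp only [map_add, Derivation.map_smul, add_apply, smul_apply]
    simp only [e, Finset.sum_add_distrib, ← Finset.mul_sum, divOp_apply, zero_mul, add_zero,
      sum_apply, hf, hg]
  have hAu : ∀ i, pdu (fun z => A z i) (x, u) = f i x * u + g i x := fun i => by
    refine (hasDerivAt_fibre (hAi i) x u).unique ?_
    have h1 := ((((hasDerivAt_id u).pow 2).div_const 2).mul_const ((f i).extend x)).add
      ((hasDerivAt_id u).mul_const ((g i).extend x))
    exact h1.congr_deriv (by simp [extend_apply]; ring)
  have h₀' := congrArg (fun f : SmoothFun U => f x) h₀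
  have hb' := congrArg (fun f : SmoothFun U => f x) hb
  simp only [defect₀, sub_apply, mul_apply, neg_apply, zero_apply, hT] at h₀' hb'
  refine ⟨?_, fun p => ⟨?_, ?_, ?_⟩⟩
  · rw [hAx, hv, hX.eta]
    simp only [pdx_of_affine (hX.xi _), map_zero, zero_apply, zero_mul, zero_add]
    rw [divergence, sum_apply] at h₀'
    linear_combination u ^ 2 / 2 * h₀' - u * hb'
  · simp only [hAu, pdu_of_affine (hX.xi _), pdx_of_affine hX.eta, hf, hg, sum_apply, mul_apply,
      zero_apply, mul_zero, Finset.sum_const_zero, sub_zero, Finset.sum_mul, Finset.mul_sum,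
      ← Finset.sum_add_distrib, ← Finset.sum_sub_distrib]
    exact Finset.sum_eq_zero fun i _ => Finset.sum_eq_zero fun j _ => by ring
  · rw [hX.noetherQuadratic hW]
    rw [sum_mul_eq_zero_of_symm (fun j k => by rw [← add_apply, h₂, zero_apply])
      fun j k => mul_comm _ _, mul_zero]
  · simp [pdu_of_affine (hX.xi _)]

end PointField

/-! ### The Lie algebras of Lie and of Noether symmetries -/

namespace PointField

section Affine

variable {X Y : PointField U} {ξ ξ₁ ξ₂ : Fin d → SmoothFun U} {a a₁ a₂ b b₁ b₂ : SmoothFun U}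

theorem isAffine_zero : (0 : PointField U).IsAffine 0 0 0 := fun x u => by
  simp [val_zero]; rfl

theorem isAffine_scaling : (scaling U).IsAffine 0 1 0 := fun x u => by
  have h : (scaling U).val (x, u) = (0, u) := if_pos x.2
  rw [h]
  simp; rfl

theorem IsAffine.add (hX : X.IsAffine ξ₁ a₁ b₁) (hY : Y.IsAffine ξ₂ a₂ b₂) :
    (X + Y).IsAffine (ξ₁ + ξ₂) (a₁ + a₂) (b₁ + b₂) := fun x u => by
  rw [val_add, Pi.add_apply, hX x u, hY x u]
  refine Prod.ext (funext fun k => rfl) ?_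
  simp; ring

theorem IsAffine.smul (c : ℝ) (hX : X.IsAffine ξ a b) :
    (c • X).IsAffine (c • ξ) (c • a) (c • b) := fun x u => by
  rw [val_smul, Pi.smul_apply, hX x u]
  refine Prod.ext (funext fun k => rfl) ?_
  simp; ring

theorem IsAffine.unique (h₁ : X.IsAffine ξ₁ a₁ b₁) (h₂ : X.IsAffine ξ₂ a₂ b₂) :
    ξ₁ = ξ₂ ∧ a₁ = a₂ ∧ b₁ = b₂ := by
  have h := fun x u => (h₁ x u).symm.trans (h₂ x u)
  have hb : b₁ = b₂ := SmoothFun.ext_apply fun x => by simpa using congrArg Prod.snd (h x 0)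
  refine ⟨funext fun k => SmoothFun.ext_apply fun x => congrFun (congrArg Prod.fst (h x 0)) k,
    SmoothFun.ext_apply fun x => ?_, hb⟩
  simpa [hb] using congrArg Prod.snd (h x 1)

theorem IsAffine.fderiv_val (hX : X.IsAffine ξ a b) (x : U) (u : ℝ) (v : J0 d) :
    fderiv ℝ X.val (x, u) v
      = (fun k => along v.1 (ξ k) x, along v.1 a x * u + a x * v.2 + along v.1 b x) := by
  have hd := (X.differentiableAt (z := ((x : Coord d), u)) x.2).hasFDerivAt
  refine Prod.ext (funext fun k => ?_) ?_
  · have h1 : fderiv ℝ (X.xi k) ((x : Coord d), u) v = (fderiv ℝ X.val (x, u) v).1 k :=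
      congrArg (fun T => T v) ((hasFDerivAt_pi'.1 hd.fst) k).fderiv
    rw [← h1, fderiv_of_affine (hX.xi k)]
    simp [along]
  · have h1 : fderiv ℝ X.eta ((x : Coord d), u) v = (fderiv ℝ X.val (x, u) v).2 :=
      congrArg (fun T => T v) hd.snd.fderiv
    rw [← h1, fderiv_of_affine hX.eta]

theorem IsAffine.lie (hX : X.IsAffine ξ₁ a₁ b₁) (hY : Y.IsAffine ξ₂ a₂ b₂) :
    ⁅X, Y⁆.IsAffine (flowBracket deriv ξ₁ ξ₂)
      (vectorDeriv deriv ξ₁ a₂ - vectorDeriv deriv ξ₂ a₁)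
      ((vectorDeriv deriv ξ₁ b₂ - a₁ * b₂) - (vectorDeriv deriv ξ₂ b₁ - a₂ * b₁)) := by
  intro x u
  have hv : ∀ (ξ : Fin d → SmoothFun U) (f : SmoothFun U),
      along (fun k => ξ k x) f x = vectorDeriv deriv ξ f x := fun ξ f => by
    rw [vectorDeriv_apply]; simp [along]
  rw [val_lie, VectorField.lieBracket, hY.fderiv_val, hX.fderiv_val, hX x u, hY x u]
  refine Prod.ext (funext fun k => ?_) ?_
  · simp [flowBracket, hv]
  · simp [hv]
    ring

end Affine

section Algebras

/-- The affine fields with `T Q = Q' T` for some `a'` and with `T b = 0`. -/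
def symmetryAlgebra (W : Fin d → Fin d → SmoothFun U) (Z : SmoothFun U) :
    LieSubalgebra ℝ (PointField U) where
  carrier := {X | ∃ ξ a a' b, X.IsAffine ξ a b ∧ Intertwines deriv W Z ξ a a' ∧
    divOp deriv W Z b = 0}
  add_mem' := fun ⟨_, _, _, _, h, h', hb⟩ ⟨_, _, _, _, k, k', kb⟩ =>
    ⟨_, _, _, _, h.add k, h'.add k', by rw [map_add, hb, kb, add_zero]⟩
  zero_mem' := ⟨0, 0, 0, 0, isAffine_zero, intertwines_zero, map_zero _⟩
  smul_mem' := fun c _ ⟨_, _, _, _, h, h', hb⟩ =>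
    ⟨_, _, _, _, h.smul c, h'.smul c, by rw [map_smul, hb, smul_zero]⟩
  lie_mem' := fun ⟨_, _, _, _, h, h', hb⟩ ⟨_, _, _, _, k, k', kb⟩ =>
    ⟨_, _, _, _, h.lie k, h'.bracket deriv_comm k', by
      rw [map_sub, h', k', hb, kb]; simp⟩

/-- The affine fields with `T Q = Q' T` for `a' = -a - ∂_k ξ^k` and with `T b = 0`. -/
def variationalAlgebra (W : Fin d → Fin d → SmoothFun U) (Z : SmoothFun U) :
    LieSubalgebra ℝ (PointField U) where
  carrier := {X | ∃ ξ a b, X.IsAffine ξ a b ∧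
    Intertwines deriv W Z ξ a (-a - divergence deriv ξ) ∧ divOp deriv W Z b = 0}
  add_mem' := fun ⟨_, _, _, h, h', hb⟩ ⟨_, _, _, k, k', kb⟩ =>
    ⟨_, _, _, h.add k, by
      convert h'.add k' using 1
      rw [divergence_add]; ring, by rw [map_add, hb, kb, add_zero]⟩
  zero_mem' := ⟨0, 0, 0, isAffine_zero, by
    rw [divergence_zero, neg_zero, sub_zero]; exact intertwines_zero, map_zero _⟩
  smul_mem' := fun c _ ⟨_, _, _, h, h', hb⟩ =>
    ⟨_, _, _, h.smul c, by
      convert h'.smul c using 1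
      rw [divergence_smul, smul_sub, smul_neg], by rw [map_smul, hb, smul_zero]⟩
  lie_mem' := fun ⟨_, _, _, h, h', hb⟩ ⟨_, _, _, k, k', kb⟩ =>
    ⟨_, _, _, h.lie k, by
      convert h'.bracket deriv_comm k' using 1
      rw [divergence_flowBracket deriv_comm]; simp only [map_sub, map_neg]; ring, by
      rw [map_sub, h', k', hb, kb]; simp⟩

variable {W : Fin d → Fin d → SmoothFun U} {Z : SmoothFun U}

theorem variationalAlgebra_le : variationalAlgebra W Z ≤ symmetryAlgebra W Z :=
  fun _ ⟨ξ, a, b, h, h', hb⟩ => ⟨ξ, a, _, b, h, h', hb⟩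

theorem scaling_mem : scaling U ∈ symmetryAlgebra W Z :=
  ⟨0, 1, 1, 0, isAffine_scaling, intertwines_scaling, map_zero _⟩

theorem scaling_notMem (hW : ∀ i j, W i j = W j i) {x : U} (hne : ∃ i j, W i j x ≠ 0) :
    scaling U ∉ variationalAlgebra W Z := by
  rintro ⟨ξ, a, b, h, h', -⟩
  obtain ⟨rfl, rfl, rfl⟩ := isAffine_scaling.unique h
  obtain ⟨i, j, hij⟩ := hne
  have h1 := congrArg (fun f : SmoothFun U => f x) ((h'.defect deriv_comm hW deriv_coord).1 i j)
  simp [defect₂, divergence_zero, vectorDeriv_zero, hW j i] at h1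
  norm_num at h1
  exact hij h1

/-- The constant is half of the value of `∂_k ξ^k + a + a'`, which is constant on the connected
domain. -/
theorem exists_sub_smul_scaling_mem (hU : IsPreconnected (U : Set (Coord d)))
    (hW : ∀ i j, W i j = W j i)
    (hdet : ∀ x, (Matrix.of fun i j => W i j x).det ≠ 0) {X : PointField U}
    (hX : X ∈ symmetryAlgebra W Z) : ∃ c : ℝ, X - c • scaling U ∈ variationalAlgebra W Z := by
  obtain ⟨ξ, a, a', b, h, h', hb⟩ := hX
  have hconst : ∀ i, deriv i (divergence deriv ξ + a + a') = 0 := by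
    obtain ⟨h₂, h₁, -⟩ := h'.defect deriv_comm hW deriv_coord
    have key : ∀ k, ∑ j, W j k * deriv j (divergence deriv ξ + a + a') = 0 := fun k => by
      have h := sum_deriv_defect₂ (ξ := ξ) (a := a) (a' := a') deriv_comm hW k
      simp only [h₂, h₁, map_zero, Finset.sum_const_zero, zero_add] at h
      refine SmoothFun.ext_apply fun x => ?_
      simpa using congrArg (fun f : SmoothFun U => f x) h.symm
    intro i
    refine SmoothFun.ext_apply fun x => ?_
    refine congrFun (Matrix.eq_zero_of_mulVec_eq_zero
      (v := fun i => deriv i (divergence deriv ξ + a + a') x) (hdet x) (funext fun k => ?_)) i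
    have := congrArg (fun f : SmoothFun U => f x) (key k)
    simp only [sum_apply, mul_apply, hW _ k] at this
    exact this
  obtain ⟨c, hc⟩ := exists_eq_algebraMap hU _ hconst
  have hc' : algebraMap ℝ (SmoothFun U) c = (c / 2) • 1 + (c / 2) • (1 : SmoothFun U) := by
    rw [← add_smul, add_halves, Algebra.algebraMap_eq_smul_one]
  refine ⟨c / 2, _, _, _, by
    rw [sub_eq_add_neg, ← neg_smul]; exact h.add (isAffine_scaling.smul _), ?_, ?_⟩
  · have h1 := h'.add (intertwines_scaling (D := deriv) (W := W) (Z := Z) |>.smul (-(c / 2)))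
    convert h1 using 1
    rw [divergence_add, divergence_smul, divergence_zero]
    simp only [neg_smul, smul_zero, add_zero]
    linear_combination -hc - hc'
  · simp [hb]

/-- The fields `b ∂_u` with `T b = 0`, as an ideal of a Lie algebra of symmetries. -/
def superpositionIdeal (L : LieSubalgebra ℝ (PointField U)) (hL : L ≤ symmetryAlgebra W Z) :
    LieIdeal ℝ L where
  carrier := {X | ∃ b, X.1.IsAffine 0 0 b ∧ divOp deriv W Z b = 0}
  add_mem' := fun ⟨_, h, hb⟩ ⟨_, k, kb⟩ =>
    ⟨_, by simpa using h.add k, by rw [map_add, hb, kb, add_zero]⟩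
  zero_mem' := ⟨0, isAffine_zero, map_zero _⟩
  smul_mem' := fun c _ ⟨_, h, hb⟩ =>
    ⟨_, by simpa using h.smul c, by rw [map_smul, hb, smul_zero]⟩
  lie_mem := by
    rintro X Y ⟨b, h, hb⟩
    obtain ⟨ξ, a, a', b₁, k, k', kb⟩ := hL X.2
    refine ⟨vectorDeriv deriv ξ b - a * b, ?_, ?_⟩
    · have := k.lie h
      simpa [flowBracket_zero, vectorDeriv_zero] using this
    · rw [k', hb]; simp

theorem superposition_mem {X : PointField U} {b : SmoothFun U} (h : X.IsAffine 0 0 b)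
    (hb : divOp deriv W Z b = 0) : X ∈ variationalAlgebra W Z :=
  ⟨0, 0, b, h, by rw [divergence_zero, neg_zero, sub_zero]; exact intertwines_zero, hb⟩

end Algebras

section KleinGordonSymmetries

variable {g : Coord d → Matrix (Fin d) (Fin d) ℝ} {V : Coord d → ℝ} {X : PointField U}

theorem mem_symmetryAlgebra_iff (hd : 2 ≤ d) (hg : IsMetric U g) (hV : ContDiffOn ℝ ∞ V U) :
    X ∈ symmetryAlgebra hg.density (hg.potential hV) ↔ X.IsLieSymmetry g V := by
  rw [isLieSymmetry_iff_jet hg hV]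
  constructor
  · rintro ⟨ξ, a, a', b, h, h', hb⟩
    exact h.preservesEquation hg.density_symm h' hb
  · intro h
    have h : X.PreservesEquation hg.density (hg.potential hV) := h
    obtain ⟨ξ, a, b, hX⟩ := h.isAffine hd hg.density_symm hg.density_det_ne_zero
    obtain ⟨a', h1, h2⟩ := h.intertwines hd hg.density_symm hg.density_det_ne_zero hX
    exact ⟨ξ, a, a', b, hX, h1, h2⟩

theorem mem_variationalAlgebra_iff (hd : 2 ≤ d) (hg : IsMetric U g) (hV : ContDiffOn ℝ ∞ V U) :
    X ∈ variationalAlgebra hg.density (hg.potential hV) ↔ X.IsNoetherSymmetry g V := by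
  rw [isNoetherSymmetry_iff_jet hg hV]
  constructor
  · rintro ⟨ξ, a, b, h, h', hb⟩
    exact h.exists_preservesLagrangian hg.density_symm h' hb
  · rintro ⟨A, hA, h⟩
    have h : X.PreservesLagrangian hg.density (hg.potential hV) A := h
    obtain ⟨ξ, a, b, hX⟩ := h.isAffine hg.density_symm
      (exists_entry_ne_zero hg.density_det_ne_zero hd)
    exact ⟨ξ, a, b, hX, h.intertwines hA hg.density_symm hX⟩

theorem isSuperposition_iff (hg : IsMetric U g) (hV : ContDiffOn ℝ ∞ V U) :
    X.IsSuperposition g V ↔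
      ∃ b, X.IsAffine 0 0 b ∧ divOp deriv hg.density (hg.potential hV) b = 0 := by
  have key : ∀ (b : SmoothFun U) (F : Coord d → ℝ), (∀ x : U, F x = b x) → ∀ x : U,
      divOp deriv hg.density (hg.potential hV) b x
        = sqrtDet g x * (laplacian g F x + V x * F x) := by
    intro b F hF x
    have h1 : ∀ i, (deriv i (∑ j, hg.density i j * deriv j b)) x
        = pd i (fun y => sqrtDet g y * ∑ j, (g y)⁻¹ i j * pd j F y) x := fun i =>
      deriv_apply_of_eq i (fun y => by
        simp only [sum_apply, mul_apply, Finset.mul_sum, ← mul_assoc,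
          deriv_apply_of_eq _ hF]
        rfl) x
    have h2 : hg.potential hV x = sqrtDet g x * V x := rfl
    have := hg.sqrtDet_ne_zero x.2
    rw [divOp_apply, add_apply, sum_apply, mul_apply, h2, laplacian, hF]
    simp only [h1]
    field_simp
  constructor
  · rintro ⟨b, hb, hb', h⟩
    refine ⟨restrict b hb, fun x u => ?_, SmoothFun.ext_apply fun x => ?_⟩
    · rw [h x x.2]; simp; exact ⟨rfl, rfl⟩
    · rw [key _ b (fun _ => rfl), hb' x x.2, mul_zero, zero_apply]
  · rintro ⟨b, h, hb⟩
    refine ⟨b.extend, b.contDiffOn_extend, fun x hx => ?_, fun x hx u => ?_⟩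
    · have := key b b.extend b.extend_apply ⟨x, hx⟩
      rw [hb] at this
      exact (mul_eq_zero.1 this.symm).resolve_left (hg.sqrtDet_ne_zero hx)
    · rw [h ⟨x, hx⟩ u, b.extend_apply ⟨x, hx⟩]; simp; rfl

end KleinGordonSymmetries

end PointField

/-! ### Dimensions -/

universe v

theorem rank_ker_of_apply_eq_one {M : Type v} [AddCommGroup M] [Module ℝ M] (f : M →ₗ[ℝ] ℝ) {s : M}
    (hs : f s = 1) {n : ℕ} (h : Module.rank ℝ M = n) :
    1 ≤ n ∧ Module.rank ℝ (LinearMap.ker f) = (n - 1 : ℕ) := by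
  have hr : LinearMap.range f = ⊤ := LinearMap.range_eq_top.2 fun c => ⟨c • s, by simp [hs]⟩
  have h1 := LinearMap.lift_rank_range_add_rank_ker f
  rw [hr, rank_top, Module.rank_self, h] at h1
  simp only [Cardinal.lift_one, Cardinal.lift_natCast] at h1
  have hlt : Module.rank ℝ (LinearMap.ker f) < Cardinal.aleph0 :=
    lt_of_le_of_lt (Submodule.rank_le _) (h ▸ Cardinal.natCast_lt_aleph0)
  obtain ⟨k, hk⟩ := Cardinal.lt_aleph0.1 hlt
  rw [hk] at h1 ⊢
  norm_num at h1
  have h2 : 1 + k = n := by exact_mod_cast h1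
  exact ⟨by omega, by norm_cast; omega⟩

/-- A subspace of codimension one, given as the kernel of `f` and the range of `ι`, still has
codimension one modulo a subspace contained in it. -/
theorem rank_quotient_of_range_eq_ker {L N : Type v} [AddCommGroup L] [Module ℝ L] [AddCommGroup N]
    [Module ℝ N] (ι : N →ₗ[ℝ] L) (f : L →ₗ[ℝ] ℝ) {s : L} (hs : f s = 1)
    (hf : LinearMap.range ι = LinearMap.ker f) (I : Submodule ℝ L) (hI : I ≤ LinearMap.ker f)
    (J : Submodule ℝ N) (hJ : J = I.comap ι) {n : ℕ} (h : Module.rank ℝ (L ⧸ I) = n) :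
    1 ≤ n ∧ Module.rank ℝ (N ⧸ J) = (n - 1 : ℕ) := by
  have h1 := rank_ker_of_apply_eq_one (I.liftQ f hI) (s := I.mkQ s) (by simpa using hs) h
  have hker : LinearMap.ker (I.mkQ ∘ₗ ι) = J := by
    rw [LinearMap.ker_comp, Submodule.ker_mkQ, hJ]
  have hrange : LinearMap.range (I.mkQ ∘ₗ ι) = LinearMap.ker (I.liftQ f hI) := by
    rw [LinearMap.range_comp, hf, Submodule.ker_liftQ]
  refine ⟨h1.1, ?_⟩
  rw [← h1.2, ← hrange, ← hker]
  exact (LinearMap.quotKerEquivRange _).rank_eq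

end KleinGordon
end

theorem mainTheorem2 (d : ℕ) (hd : 2 ≤ d)
    (U : TopologicalSpace.Opens (KleinGordon.Coord d))
    (hU : IsConnected (U : Set (KleinGordon.Coord d)))
    (g : KleinGordon.Coord d → Matrix (Fin d) (Fin d) ℝ) (hg : KleinGordon.IsMetric U g)
    (V : KleinGordon.Coord d → ℝ) (hV : ContDiffOn ℝ ∞ V U) :
    ∃ (GLS GNS : LieSubalgebra ℝ (KleinGordon.PointField U))
      (IL : LieIdeal ℝ GLS) (IN : LieIdeal ℝ GNS),
      -- `GLS`, `GNS` consist of all Lie resp. Noether point symmetries,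
      -- `IL`, `IN` of the superposition fields in them
      (∀ X, X ∈ GLS ↔ X.IsLieSymmetry g V) ∧
      (∀ X, X ∈ GNS ↔ X.IsNoetherSymmetry g V) ∧
      (∀ X : GLS, X ∈ IL ↔ X.1.IsSuperposition g V) ∧
      (∀ X : GNS, X ∈ IN ↔ X.1.IsSuperposition g V) ∧
      (∀ X, X.IsSuperposition g V → X ∈ GLS ∧ X ∈ GNS) ∧
      -- the relation between the two algebras
      GNS ≤ GLS ∧
      KleinGordon.PointField.scaling U ∈ GLS ∧
      KleinGordon.PointField.scaling U ∉ GNS ∧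
      GLS.toSubmodule = GNS.toSubmodule ⊔ Submodule.span ℝ {KleinGordon.PointField.scaling U} ∧
      Disjoint GNS.toSubmodule (Submodule.span ℝ {KleinGordon.PointField.scaling U}) ∧
      -- dimensions, modulo superposition fields
      (∀ n : ℕ, Module.rank ℝ (GLS ⧸ IL) = n →
        1 ≤ n ∧ Module.rank ℝ (GNS ⧸ IN) = (n - 1 : ℕ)) ∧
      -- dimensions, for a Lie algebra spanned by `n` Lie point symmetries, `u ∂_u` among them
      (∀ (n : ℕ) (G : LieSubalgebra ℝ (KleinGordon.PointField U)),
        G ≤ GLS → KleinGordon.PointField.scaling U ∈ G → Module.rank ℝ G = n →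
        1 ≤ n ∧ Module.rank ℝ (G ⊓ GNS : LieSubalgebra ℝ (KleinGordon.PointField U)) = (n - 1 : ℕ) ∧
        G.toSubmodule = (G ⊓ GNS).toSubmodule ⊔
          Submodule.span ℝ {KleinGordon.PointField.scaling U}) := by
  open KleinGordon KleinGordon.PointField in
  obtain ⟨x₀, hx₀⟩ := hU.nonempty
  set s := scaling U
  have hne := exists_entry_ne_zero hg.density_det_ne_zero hd ⟨x₀, hx₀⟩
  set L := symmetryAlgebra hg.density (hg.potential hV)
  set N := variationalAlgebra hg.density (hg.potential hV)
  have hNL : N ≤ L := variationalAlgebra_le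
  have hsL : s ∈ L := scaling_mem
  have hsN : s ∉ N := scaling_notMem hg.density_symm hne
  have hdec : ∀ {X}, X ∈ L → ∃ c : ℝ, X - c • s ∈ N := fun hX =>
    exists_sub_smul_scaling_mem hU.isPreconnected hg.density_symm hg.density_det_ne_zero hX
  have hsup : ∀ X, X.IsSuperposition g V → X ∈ N := fun X hX => by
    obtain ⟨b, h, hb⟩ := (isSuperposition_iff hg hV).1 hX
    exact superposition_mem h hb
  -- A linear functional that vanishes on `N` and takes the value `1` at `s`.
  obtain ⟨φ, hφs, hφN⟩ : ∃ φ : PointField U →ₗ[ℝ] ℝ, φ s = 1 ∧ ∀ X ∈ N, φ X = 0 := by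
    obtain ⟨ψ, h1, h2⟩ := Submodule.exists_le_ker_of_notMem (p := N.toSubmodule) hsN
    exact ⟨(ψ s)⁻¹ • ψ, by simp [h1], fun X hX => by
      have : ψ X = 0 := h2 hX
      simp [this]⟩
  have hmem : ∀ {X}, X ∈ L → (X ∈ N ↔ φ X = 0) := fun {X} hX => ⟨hφN X, fun h => by
    obtain ⟨c, hc⟩ := hdec hX
    have h0 := hφN _ hc
    rw [map_sub, map_smul, h, hφs, smul_eq_mul, mul_one, zero_sub, neg_eq_zero] at h0
    simpa [h0] using hc⟩
  have hsplit : ∀ G : LieSubalgebra ℝ (PointField U), G ≤ L → s ∈ G →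
      G.toSubmodule = (G ⊓ N).toSubmodule ⊔ Submodule.span ℝ {s} := fun G hG hsG => by
    refine le_antisymm (fun X hX => ?_) (sup_le (fun X hX => hX.1) ?_)
    · obtain ⟨c, hc⟩ := hdec (hG hX)
      refine Submodule.mem_sup.2 ⟨X - c • s, ⟨G.sub_mem hX (G.smul_mem c hsG), hc⟩, c • s,
        Submodule.smul_mem _ _ (Submodule.mem_span_singleton_self s), sub_add_cancel _ _⟩
    · rwa [Submodule.span_singleton_le_iff_mem]
  refine ⟨L, N, superpositionIdeal L le_rfl, superpositionIdeal N hNL,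
    fun X => mem_symmetryAlgebra_iff hd hg hV, fun X => mem_variationalAlgebra_iff hd hg hV,
    fun X => (isSuperposition_iff hg hV).symm, fun X => (isSuperposition_iff hg hV).symm,
    fun X hX => ⟨hNL (hsup X hX), hsup X hX⟩, hNL, hsL, hsN, ?_, ?_, fun n hn => ?_,
    fun n G hG hsG hn => ?_⟩
  · have := hsplit L le_rfl hsL
    rwa [inf_eq_right.2 hNL] at this
  · rw [Submodule.disjoint_def]
    intro X hX hX'
    obtain ⟨c, rfl⟩ := Submodule.mem_span_singleton.1 hX'
    have := hφN _ hX
    rw [map_smul, hφs, smul_eq_mul, mul_one] at this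
    rw [this, zero_smul]
  · refine rank_quotient_of_range_eq_ker (Submodule.inclusion (p := N.toSubmodule)
      (p' := L.toSubmodule) hNL) (φ ∘ₗ L.toSubmodule.subtype) (s := ⟨s, hsL⟩) hφs ?_
      (superpositionIdeal L le_rfl).toSubmodule ?_ (superpositionIdeal N hNL).toSubmodule rfl hn
    · ext X
      rw [Submodule.range_inclusion]
      exact hmem X.2
    · intro X hX
      exact hφN _ (hsup _ ((isSuperposition_iff hg hV).2 hX))
  · have h := rank_ker_of_apply_eq_one (φ ∘ₗ G.toSubmodule.subtype) (s := ⟨s, hsG⟩) hφs hn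
    refine ⟨h.1, ?_, hsplit G hG hsG⟩
    rw [← h.2]
    have hle : (G ⊓ N).toSubmodule ≤ G.toSubmodule := fun X hX => hX.1
    have hk : LinearMap.ker (φ ∘ₗ G.toSubmodule.subtype)
        = (G ⊓ N).toSubmodule.comap G.toSubmodule.subtype := by
      ext X
      exact (hmem (hG X.2)).symm.trans ⟨fun h => ⟨X.2, h⟩, fun h => h.2⟩
    rw [hk]
    exact (Submodule.comapSubtypeEquivOfLe hle).rank_eq.symm
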